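/- Let $X$ and $Y$ be $\sigma$-compact metric spaces with their Borel $\sigma$-algebras, and let $\sigma$ on $X$ and $\mu$ on $Y$ be diffuse Borel measures that are finite on compact sets. Let $\Omega^X$ be the space of configurations on $X$, i.e. of locally finite subsets $\omega\subset X$, each identified with the point measure $\omega=\sum_{x\in\omega}\epsilon_x$, where $\epsilon_x$ is the Dirac measure at $x$; equip $\Omega^X$ with the $\sigma$-algebra generated by the maps $\omega\mapsto\omega(B)$, $B$ Borel, and define $\Omega^Y$ in the same way. Let $\pi_\sigma$ be the Poisson measure with intensity $\sigma$, i.e. the probability measure on $\Omega^X$ under which, for all pairwise disjoint compact sets $A_1,\dots,A_n\subset X$, the random variables $\omega(A_1),\dots,\omega(A_n)$ are independent and Poisson distributed with parameters $\sigma(A_1),\dots,\sigma(A_n)$; define $\pi_\mu$ on $\Omega^Y$ in the same way. Let $\tau:\Omega^X\times X\to Y$ be a measurable map such that $$\tau(\omega,\cdot)_*\sigma=\mu\qquad\text{for every }\omega\in\Omega^X,$$ and which satisfies the cyclic condition $$D_{t_1}\tau(\omega,t_2)\,D_{t_2}\tau(\omega,t_3)\cdots D_{t_k}\tau(\omega,t_1)=0\qquad\text{for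 all }k\ge 1,\ \omega\in\Omega^X,\ t_1,\dots,t_k\in X,$$ which means that, with $t_{k+1}=t_1$, there is $i\in\{1,\dots,k\}$ such that $\tau(\omega\cup\{t_i\},t_{i+1})=\tau(\omega,t_{i+1})$. Let $$\tau_*(\omega)=\sum_{x\in\omega}\epsilon_{\tau(\omega,x)},\qquad \omega\in\Omega^X.$$ Then $\tau_*(\omega)\in\Omega^Y$ for $\pi_\sigma$-almost every $\omega$, and $\tau_*$ maps $\pi_\sigma$ to $\pi_\mu$, i.e. $\tau_*\pi_\sigma=\pi_\mu$ is the Poisson measure on $Y$ with intensity $\mu$. -/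

import Mathlib

open MeasureTheory ProbabilityTheory

/-- The configuration space over `X`: subsets of `X` with finitely many points in each compact set.
In a metric space this is the same as local finiteness, and in a σ-compact space such a set is
automatically at most countable. -/
@[ext]
structure Config (X : Type*) [TopologicalSpace X] where
  carrier : Set X
  finite_inter : ∀ K : Set X, IsCompact K → (carrier ∩ K).Finite

namespace Config

section Topological

variable {X Y : Type*} [TopologicalSpace X] [TopologicalSpace Y]

/-- The empty configuration. -/
def empty : Config X where
  carrier := ∅
  finite_inter := fun K _ => by simp

/-- The configuration `ω ∪ {x}`. -/
def add (ω : Config X) (x : X) : Config X where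
  carrier := ω.carrier ∪ {x}
  finite_inter := fun K hK =>
    ((ω.finite_inter K hK).union (Set.finite_singleton x)).subset (by
      rintro y ⟨hy | hy, hyK⟩
      · exact Or.inl ⟨hy, hyK⟩
      · exact Or.inr hy)

/-- The number `ω(A)` of points of `ω` in `A`, used for compact sets `A`, where it is finite. -/
noncomputable def count (A : Set X) (ω : Config X) : ℕ := (ω.carrier ∩ A).ncard

open Classical in
/-- The map `τ_*` between configuration spaces induced by `τ`: it moves each `x ∈ ω` to `τ ω x`.
If two points of `ω` collide or if the image is not locally finite, then the image is not a
configuration on `Y` and the value is the empty configuration by convention. -/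
noncomputable def push (τ : Config X → X → Y) (ω : Config X) : Config Y :=
  if h : Set.InjOn (τ ω) ω.carrier ∧
      ∀ K : Set Y, IsCompact K → ((τ ω '' ω.carrier) ∩ K).Finite then
    ⟨τ ω '' ω.carrier, h.2⟩
  else empty

/-- `D_s τ(ω, t) = 0`, i.e. `τ(ω ∪ {s}, t) = τ(ω, t)`. -/
def DiffVanishes (τ : Config X → X → Y) (s : X) (ω : Config X) (t : X) : Prop :=
  τ (ω.add s) t = τ ω t

/-- The cyclic condition `D_{t₁} τ(ω, t₂) ⋯ D_{t_k} τ(ω, t₁) = 0` for all `k ≥ 1`, all `ω` and all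
`t₁, …, t_k`: at least one of the factors vanishes. Here `k = m + 1`, and the addition `i + 1` in
`Fin (m + 1)` is cyclic. -/
def CyclicCondition (τ : Config X → X → Y) : Prop :=
  ∀ (m : ℕ) (ω : Config X) (t : Fin (m + 1) → X),
    ∃ i : Fin (m + 1), DiffVanishes τ (t i) ω (t (i + 1))

end Topological

section Measurable

variable {X Y : Type*} [TopologicalSpace X] [MeasurableSpace X]

/-- The point measure `∑_{x ∈ ω} ε_x`. -/
noncomputable def toMeasure (ω : Config X) : Measure X :=
  Measure.sum fun x : ω.carrier => Measure.dirac (x : X)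

/-- The image measure `∑_{x ∈ ω} ε_{τ(ω, x)}`, with multiplicities. -/
noncomputable def imageMeasure [MeasurableSpace Y] (τ : Config X → X → Y) (ω : Config X) :
    Measure Y :=
  Measure.sum fun x : ω.carrier => Measure.dirac (τ ω x)

/-- The σ-algebra on the configuration space generated by the maps `ω ↦ ω(B)`, `B` measurable. -/
noncomputable instance instMeasurableSpace : MeasurableSpace (Config X) :=
  MeasurableSpace.comap toMeasure inferInstance

/-- `P` is the Poisson measure with intensity `σ`: it is a probability measure on the configuration
space under which, for all pairwise disjoint compact sets `A₁, …, A_n`, the random variables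
`ω(A₁), …, ω(A_n)` are independent and Poisson distributed with parameters
`σ(A₁), …, σ(A_n)`. -/
structure IsPoissonMeasure (σ : Measure X) (P : Measure (Config X)) : Prop where
  isProbabilityMeasure : IsProbabilityMeasure P
  hasLaw_count : ∀ A : Set X, IsCompact A →
    HasLaw (count A) (poissonMeasure (σ A).toNNReal) P
  iIndepFun_count : ∀ (n : ℕ) (A : Fin n → Set X), (∀ i, IsCompact (A i)) →
    Pairwise (fun i j => Disjoint (A i) (A j)) → iIndepFun (fun i => count (A i)) P

end Measurable

end Config

/-! By the cyclic condition, adding finitely many points `x₁, …, xₙ` to `ω` leaves `τ(ω, xᵢ)`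
unchanged for at least one `i`. Inclusion–exclusion over the sets of indices `i` for which
`τ(ω ∪ {x₁, …, xₙ}, xᵢ)` is replaced by `τ(ω, xᵢ)`, and induction on `n`, then show that
`x ↦ (τ(ω ∪ {x₁, …, xₙ}, xᵢ))ᵢ` maps `σⁿ` to `μⁿ`. By the iterated Mecke formula, the factorial
moment measures of the image of `π_σ` are therefore the `μⁿ`. The case `n = 1` gives local
finiteness of the image, and `n = 2` its simplicity, as the diagonal is `μ²`-null. Expanding
`∏ (1 - (1 - e^{-f}))` over the points of the image and integrating the alternating series termwise
identifies its Laplace functional as that of the Poisson measure with intensity `μ`. -/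

open Filter Function Topology
open scoped BoundedContinuousFunction ENNReal NNReal

lemma nonempty_periodicPts {α : Type*} [Finite α] [Nonempty α] (g : α → α) :
    (periodicPts g).Nonempty := by
  obtain ⟨a⟩ := ‹Nonempty α›
  obtain ⟨i, j, hij, h⟩ := Finite.exists_ne_map_eq_of_infinite fun n : ℕ => g^[n] a
  wlog hlt : i < j generalizing i j
  · exact this j i hij.symm h.symm (by lia)
  refine ⟨g^[i] a, j - i, Nat.sub_pos_of_lt hlt, ?_⟩
  rw [IsPeriodicPt, IsFixedPt, ← iterate_add_apply, Nat.sub_add_cancel hlt.le]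
  exact h.symm

namespace Config

section Combinatorics

variable {X Y ι : Type*} [TopologicalSpace X] [Finite ι]

/-- The configuration `ω ∪ {x i | i}` for a finite family of points `x`. -/
def addRange (ω : Config X) (x : ι → X) : Config X where
  carrier := ω.carrier ∪ Set.range x
  finite_inter := fun K hK => by
    rw [Set.union_inter_distrib_right]
    exact (ω.finite_inter K hK).union ((Set.finite_range x).inter_of_left K)

@[simp]
lemma carrier_add (ω : Config X) (x : X) : (ω.add x).carrier = ω.carrier ∪ {x} := rfl

@[simp]
lemma carrier_addRange (ω : Config X) (x : ι → X) :
    (ω.addRange x).carrier = ω.carrier ∪ Set.range x := rfl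

lemma add_of_mem {ω : Config X} {x : X} (hx : x ∈ ω.carrier) : ω.add x = ω := by
  ext y
  simp [hx]

@[simp]
lemma addRange_of_isEmpty [IsEmpty ι] (ω : Config X) (x : ι → X) : ω.addRange x = ω := by
  ext y
  simp

lemma addRange_comp_equiv {κ : Type*} [Finite κ] (ω : Config X) (x : ι → X) (e : κ ≃ ι) :
    ω.addRange (x ∘ e) = ω.addRange x := by
  ext y
  simp

lemma addRange_finCons {n : ℕ} (ω : Config X) (y : X) (x : Fin n → X) :
    ω.addRange (Fin.cons y x : Fin (n + 1) → X) = (ω.add y).addRange x := by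
  ext z
  simp [Fin.range_cons, or_assoc]

lemma addRange_addRange_subtype (ω : Config X) (x : ι → X) (p : ι → Prop) :
    (ω.addRange fun i : {i // p i} => x i).addRange (fun i : {i // ¬ p i} => x i) =
      ω.addRange x := by
  ext y
  simp only [carrier_addRange, Set.mem_union, Set.mem_range, Subtype.exists]
  grind

lemma add_addRange_subtype_ne (ω : Config X) (x : ι → X) (k : ι) :
    (ω.add (x k)).addRange (fun i : {i // i ≠ k} => x i) = ω.addRange x := by
  ext y
  simp only [carrier_addRange, carrier_add, Set.mem_union, Set.mem_range, Subtype.exists,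
    Set.mem_singleton_iff]
  grind

variable {τ : Config X → X → Y}

lemma CyclicCondition.add_self (hτ : CyclicCondition τ) (ω : Config X) (x : X) :
    τ (ω.add x) x = τ ω x := by
  obtain ⟨-, h⟩ := hτ 0 ω fun _ => x
  exact h

theorem CyclicCondition.exists_addRange_eq [Nonempty ι] (hτ : CyclicCondition τ)
    (ω : Config X) (x : ι → X) : ∃ i, τ (ω.addRange x) (x i) = τ ω (x i) := by
  induction h : Nat.card ι using Nat.strong_induction_on generalizing ι ω with
  | _ n ih =>
  have key (k : ι) : ∃ i, τ (ω.addRange x) (x i) = τ (ω.add (x k)) (x i) := by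
    rw [← add_addRange_subtype_ne ω x k]
    cases isEmpty_or_nonempty {i // i ≠ k} with
    | inl hk => exact ⟨k, by rw [addRange_of_isEmpty]⟩
    | inr hk =>
      have hcard : Nat.card {i // i ≠ k} < n :=
        h ▸ Finite.card_subtype_lt (p := (· ≠ k)) (not_not_intro rfl)
      obtain ⟨i, hi⟩ := ih _ hcard (ω.add (x k)) (fun i : {i // i ≠ k} => x i) rfl
      exact ⟨i, hi⟩
  choose g hg using key
  obtain ⟨p, m, hm, hp⟩ := nonempty_periodicPts g
  obtain ⟨m, rfl⟩ := Nat.exists_eq_add_one.2 hm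
  obtain ⟨i, hi⟩ := hτ m ω fun i => x (g^[i] p)
  refine ⟨g (g^[i] p), (hg _).trans ?_⟩
  suffices g (g^[i] p) = g^[(i + 1 : Fin (m + 1))] p by rw [this]; exact hi
  rw [← iterate_succ_apply' g]
  obtain rfl | him := eq_or_ne i (Fin.last m)
  · simpa using hp.eq
  · rw [Fin.val_add_one_of_lt (Fin.lt_last_iff_ne_last.2 him)]

end Combinatorics

end Config

lemma isSFiniteKernel_of_lt_top {α β : Type*} [MeasurableSpace α] [MeasurableSpace β]
    (κ : Kernel α β) (h : ∀ a, κ a Set.univ < ∞) : IsSFiniteKernel κ := by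
  classical
  have hfloor (m : ℕ) : MeasurableSet {a | ⌊(κ a Set.univ).toNNReal⌋₊ = m} :=
    Nat.measurable_floor.comp (κ.measurable_coe .univ).ennreal_toNNReal (measurableSet_singleton m)
  have hfin (m : ℕ) : IsFiniteKernel (Kernel.piecewise (hfloor m) κ 0) := by
    refine ⟨(m + 1 : ℕ), ENNReal.natCast_lt_top _, fun a => ?_⟩
    rw [Kernel.piecewise_apply]
    split_ifs with ha
    · rw [← ENNReal.coe_toNNReal (h a).ne, ← show _ = m from ha]
      exact mod_cast (Nat.lt_floor_add_one _).le
    · simp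
  have hsum : κ = Kernel.sum fun m => Kernel.piecewise (hfloor m) κ 0 := by
    ext a s hs
    rw [Kernel.sum_apply' _ _ hs, tsum_eq_single ⌊(κ a Set.univ).toNNReal⌋₊]
    · simp [Kernel.piecewise_apply]
    · intro m hm
      simp [Kernel.piecewise_apply, hm.symm]
  rw [hsum]
  infer_instance

namespace Config

section Measurability

section Topological

variable {X : Type*} [TopologicalSpace X] [MeasurableSpace X]

lemma measurable_toMeasure : Measurable (toMeasure : Config X → Measure X) :=
  comap_measurable _

lemma measurable_of_toMeasure {α : Type*} [MeasurableSpace α] {f : α → Config X}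
    (hf : Measurable fun a => (f a).toMeasure) : Measurable f :=
  measurable_comap_iff.2 hf

variable (X) in
/-- The kernel `ω ↦ ∑_{x ∈ ω} ε_x`; it is what makes sums over the points of a configuration depend
measurably on parameters. -/
noncomputable def pointKernel : Kernel (Config X) X := ⟨toMeasure, measurable_toMeasure⟩

variable [MeasurableSingletonClass X]

lemma lintegral_toMeasure (ω : Config X) (f : X → ℝ≥0∞) :
    ∫⁻ x, f x ∂ω.toMeasure = ∑' x : ω.carrier, f x := by
  simp only [toMeasure, lintegral_sum_measure, lintegral_dirac]

lemma toMeasure_apply (ω : Config X) {B : Set X} (hB : MeasurableSet B) :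
    ω.toMeasure B = (ω.carrier ∩ B).encard := by
  rw [← lintegral_indicator_one hB, lintegral_toMeasure, tsum_subtype, ← ENNReal.tsum_set_one,
    tsum_subtype (ω.carrier ∩ B) (fun _ => (1 : ℝ≥0∞)), ← Set.indicator_indicator]
  rfl

lemma toMeasure_add {ω : Config X} {x : X} (hx : x ∉ ω.carrier) :
    (ω.add x).toMeasure = ω.toMeasure + Measure.dirac x := by
  refine Measure.ext_of_lintegral _ fun f _ => ?_
  rw [lintegral_add_measure, lintegral_dirac, lintegral_toMeasure, lintegral_toMeasure,
    carrier_add, ENNReal.summable.tsum_union_disjoint (by simpa) ENNReal.summable,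
    tsum_singleton x f]

variable [T2Space X] [OpensMeasurableSpace X] {K : Set X}

lemma toMeasure_apply_of_isCompact (hK : IsCompact K) (ω : Config X) :
    ω.toMeasure K = count K ω := by
  rw [toMeasure_apply ω hK.measurableSet, count, ← (ω.finite_inter K hK).cast_ncard_eq,
    ENat.toENNReal_coe]

lemma measurable_count (hK : IsCompact K) : Measurable (count K : Config X → ℕ) := by
  have hcount : (count K : Config X → ℕ) = fun ω => ⌊(ω.toMeasure K).toNNReal⌋₊ := by
    ext ω
    simp [toMeasure_apply_of_isCompact hK]
  rw [hcount]
  exact Nat.measurable_floor.comp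
    ((Measure.measurable_coe hK.measurableSet).comp measurable_toMeasure).ennreal_toNNReal

end Topological

variable {X α : Type*} [MetricSpace X] [SigmaCompactSpace X] [MeasurableSpace X] [BorelSpace X]
  [MeasurableSpace α]

instance : IsSFiniteKernel (pointKernel X) := by
  have hC (n : ℕ) : MeasurableSet (disjointed (compactCovering X) n) :=
    .disjointed (fun n => (isCompact_compactCovering X n).measurableSet) n
  have hfin (n : ℕ) : IsSFiniteKernel ((pointKernel X).restrict (hC n)) := by
    refine isSFiniteKernel_of_lt_top _ fun ω => ?_
    rw [Kernel.restrict_apply, Measure.restrict_apply_univ]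
    calc ω.toMeasure (disjointed (compactCovering X) n)
        ≤ ω.toMeasure (compactCovering X n) := measure_mono (disjointed_le _ n)
      _ < ∞ := by
        rw [toMeasure_apply_of_isCompact (isCompact_compactCovering X n)]
        exact ENNReal.natCast_lt_top _
  have hsum : pointKernel X = Kernel.sum fun n => (pointKernel X).restrict (hC n) := by
    ext1 ω
    simp only [Kernel.sum_apply, Kernel.restrict_apply]
    rw [← Measure.restrict_iUnion (disjoint_disjointed _) hC, iUnion_disjointed,
      iUnion_compactCovering, Measure.restrict_univ]
  rw [hsum]
  infer_instance

lemma measurable_lintegral_toMeasure {g : α → Config X} (hg : Measurable g) {f : α → X → ℝ≥0∞}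
    (hf : Measurable (uncurry f)) : Measurable fun a => ∫⁻ x, f a x ∂(g a).toMeasure :=
  Measurable.lintegral_kernel_prod_right (κ := (pointKernel X).comap g hg) hf

lemma measurableSet_mem : MeasurableSet {p : Config X × X | p.2 ∈ p.1.carrier} := by
  classical
  have hcount : Measurable fun p : Config X × X =>
      ∫⁻ y, (if y = p.2 then 1 else 0) ∂p.1.toMeasure :=
    measurable_lintegral_toMeasure measurable_fst <| Measurable.ite
      (measurableSet_eq_fun measurable_snd (measurable_snd.comp measurable_fst))
      measurable_const measurable_const
  convert hcount (measurableSet_singleton (0 : ℝ≥0∞)).compl using 1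
  ext ⟨ω, x⟩
  simp [lintegral_toMeasure]

lemma measurable_add : Measurable fun p : Config X × X => p.1.add p.2 := by
  classical
  have hadd (p : Config X × X) : (p.1.add p.2).toMeasure =
      if p.2 ∈ p.1.carrier then p.1.toMeasure else p.1.toMeasure + Measure.dirac p.2 := by
    split_ifs with h
    exacts [by rw [add_of_mem h], toMeasure_add h]
  refine measurable_of_toMeasure ?_
  simp only [hadd]
  have hfst : Measurable fun p : Config X × X => p.1.toMeasure :=
    measurable_toMeasure.comp measurable_fst
  exact Measurable.ite measurableSet_mem hfst
    (hfst.add (Measure.measurable_dirac.comp measurable_snd))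

lemma measurable_addRange {ι : Type*} [Finite ι] :
    Measurable fun p : Config X × (ι → X) => p.1.addRange p.2 := by
  have hfin (n : ℕ) : Measurable fun p : Config X × (Fin n → X) => p.1.addRange p.2 := by
    induction n with
    | zero => simpa only [addRange_of_isEmpty] using measurable_fst
    | succ n ih =>
      have hcons (p : Config X × (Fin (n + 1) → X)) :
          p.1.addRange p.2 = (p.1.add (p.2 0)).addRange (Fin.tail p.2) := by
        rw [← addRange_finCons, Fin.cons_self_tail]
      simp only [hcons]
      exact ih.comp (f := fun p : Config X × (Fin (n + 1) → X) => (p.1.add (p.2 0), Fin.tail p.2))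
        ((measurable_add.comp (measurable_fst.prodMk
          ((measurable_pi_apply 0).comp measurable_snd))).prodMk
          (measurable_pi_lambda _ fun i => (measurable_pi_apply (Fin.succ i)).comp measurable_snd))
  obtain ⟨n, ⟨e⟩⟩ := Finite.exists_equiv_fin ι
  simp only [← addRange_comp_equiv _ _ e.symm]
  exact (hfin n).comp (f := fun p : Config X × (ι → X) => (p.1, p.2 ∘ e.symm)) (by fun_prop)

end Measurability

end Config

section InclusionExclusion

variable {ι Y : Type*} [DecidableEq ι]

lemma sum_even_piecewise_eq_sum_odd [Fintype ι] {M : Type*} [AddCommMonoid M]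
    (F : (ι → Y) → M) {a b : ι → Y} {i₀ : ι} (h : a i₀ = b i₀) :
    ∑ S : Finset ι with Even S.card, F (S.piecewise a b) =
      ∑ S : Finset ι with ¬ Even S.card, F (S.piecewise a b) := by
  have hcard (S : Finset ι) : Even (symmDiff S {i₀}).card ↔ ¬ Even S.card := by
    by_cases hi : i₀ ∈ S
    · have hS : symmDiff S {i₀} = S.erase i₀ := by ext j; grind [Finset.mem_symmDiff]
      rw [hS, ← Finset.card_erase_add_one hi, Nat.even_add_one, not_not]
    · have hS : symmDiff S {i₀} = insert i₀ S := by ext j; grind [Finset.mem_symmDiff]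
      rw [hS, Finset.card_insert_of_notMem hi, Nat.even_add_one]
  refine Finset.sum_nbij' (symmDiff · {i₀}) (symmDiff · {i₀}) (fun S hS => ?_) (fun S hS => ?_)
    (fun S _ => symmDiff_symmDiff_cancel_right _ _) (fun S _ => symmDiff_symmDiff_cancel_right _ _)
    fun S _ => congrArg F ?_
  · simpa only [Finset.mem_filter_univ, hcard, not_not] using hS
  · simpa only [Finset.mem_filter_univ, hcard, not_not] using hS
  · ext i
    obtain rfl | hi := eq_or_ne i i₀
    · simp [Finset.piecewise, h]
    · simp [Finset.piecewise, Finset.mem_symmDiff, hi]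

variable {Ω : Type*} [MeasurableSpace Ω] [MeasurableSpace Y] {P : Measure Ω} {a b : Ω → ι → Y}

lemma measurable_piecewise_pi (ha : Measurable a) (hb : Measurable b) (S : Finset ι) :
    Measurable fun ω => S.piecewise (a ω) (b ω) := by
  refine measurable_pi_iff.2 fun i => ?_
  by_cases hi : i ∈ S
  · simpa [hi] using measurable_pi_iff.1 ha i
  · simpa [hi] using measurable_pi_iff.1 hb i

lemma sum_even_map_piecewise_eq_sum_odd [Fintype ι] (ha : Measurable a) (hb : Measurable b)
    (hab : ∀ ω, ∃ i, a ω i = b ω i) {A : Set (ι → Y)} (hA : MeasurableSet A) :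
    ∑ S : Finset ι with Even S.card, P.map (fun ω => S.piecewise (a ω) (b ω)) A =
      ∑ S : Finset ι with ¬ Even S.card, P.map (fun ω => S.piecewise (a ω) (b ω)) A := by
  have hmeas := measurable_piecewise_pi ha hb
  have hind : Measurable (A.indicator (1 : (ι → Y) → ℝ≥0∞)) := measurable_one.indicator hA
  simp only [← lintegral_indicator_one hA, lintegral_map hind (hmeas _)]
  rw [← lintegral_finsetSum _ (by fun_prop), ← lintegral_finsetSum _ (by fun_prop)]
  refine lintegral_congr fun ω => ?_
  obtain ⟨i₀, hi₀⟩ := hab ω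
  exact sum_even_piecewise_eq_sum_odd _ hi₀

lemma map_eq_of_forall_map_piecewise_eq [Finite ι] [Nonempty ι] {ν : Measure (ι → Y)}
    [SigmaFinite ν] (ha : Measurable a) (hb : Measurable b) (hab : ∀ ω, ∃ i, a ω i = b ω i)
    (h : ∀ S : Finset ι, S.Nonempty → P.map (fun ω => S.piecewise (a ω) (b ω)) = ν) :
    P.map b = ν := by
  cases nonempty_fintype ι
  have hfinite (A : Set (ι → Y)) (hA : MeasurableSet A) (hνA : ν A ≠ ∞) : P.map b A = ν A := by
    have hsum := sum_even_map_piecewise_eq_sum_odd (P := P) ha hb hab hA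
    have hcard : ∑ S : Finset ι with Even S.card, ν A = ∑ S : Finset ι with ¬ Even S.card, ν A :=
      sum_even_piecewise_eq_sum_odd (fun _ => ν A) (a := fun _ => ()) (b := fun _ => ())
        (i₀ := Classical.arbitrary ι) rfl
    have hodd : ∑ S : Finset ι with ¬ Even S.card, P.map (fun ω => S.piecewise (a ω) (b ω)) A =
        ∑ S : Finset ι with ¬ Even S.card, ν A := by
      refine Finset.sum_congr rfl fun S hS => ?_
      rw [h S (Finset.nonempty_iff_ne_empty.2 (by rintro rfl; simp at hS))]
    have hempty : (∅ : Finset ι) ∈ ({S | Even S.card} : Finset (Finset ι)) := by simp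
    rw [hodd, ← hcard, ← Finset.add_sum_erase _ _ hempty, ← Finset.add_sum_erase _ _ hempty,
      Finset.sum_congr rfl fun S hS => by
        rw [h S (Finset.nonempty_iff_ne_empty.2 (Finset.ne_of_mem_erase hS))]] at hsum
    simpa using (ENNReal.add_left_inj (ENNReal.sum_ne_top.2 fun _ _ => hνA)).1 hsum
  refine Measure.ext_of_iUnion_eq_univ (iUnion_spanningSets ν) fun n => ?_
  ext A hA
  have hAn := hA.inter (measurableSet_spanningSets ν n)
  rw [Measure.restrict_apply hA, Measure.restrict_apply hA, hfinite _ hAn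
    ((measure_mono Set.inter_subset_right).trans_lt (measure_spanningSets_lt_top ν n)).ne]

end InclusionExclusion

namespace Config

section Invariance

variable {X Y : Type*} [MetricSpace X] [SigmaCompactSpace X] [MeasurableSpace X] [BorelSpace X]
  [MeasurableSpace Y] {τ : Config X → X → Y}

lemma measurable_addRange_apply {ι : Type*} [Finite ι] (hτ : Measurable (uncurry τ)) :
    Measurable fun (p : Config X × (ι → X)) i => τ (p.1.addRange p.2) (p.2 i) :=
  measurable_pi_lambda _ fun i => hτ.comp
    (measurable_addRange.prodMk ((measurable_pi_apply i).comp measurable_snd))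

variable {σ : Measure X} [SigmaFinite σ] {μ : Measure Y} [SigmaFinite μ]

lemma map_pi_ite_of_map_pi {ι : Type*} [Fintype ι] {p : ι → Prop} [DecidablePred p]
    {ω : Config X} (hτ : Measurable (uncurry τ)) (hpush : σ.map (τ ω) = μ)
    (h : ∀ y : {i // p i} → X, (Measure.pi fun _ => σ).map
      (fun (z : {i // ¬ p i} → X) i => τ ((ω.addRange y).addRange z) (z i)) =
        Measure.pi fun _ => μ) :
    (Measure.pi fun _ => σ).map
      (fun (x : ι → X) i => if p i then τ ω (x i) else τ (ω.addRange x) (x i)) =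
        Measure.pi fun _ => μ := by
  have hτω : MeasurePreserving (τ ω) σ μ := ⟨hτ.comp measurable_prodMk_left, hpush⟩
  have hskew := (measurePreserving_pi (ι := {i // p i}) _ _ fun _ => hτω).skew_product
    (g := fun y (z : {i // ¬ p i} → X) i => τ ((ω.addRange y).addRange z) (z i))
    ((measurable_addRange_apply hτ).comp
      ((measurable_addRange.comp (measurable_prodMk_left (x := ω))).prodMap measurable_id))
    (ae_of_all _ h)
  convert ((measurePreserving_piEquivPiSubtypeProd (fun _ => μ) p).symm.comp hskew |>.comp
    (measurePreserving_piEquivPiSubtypeProd (fun _ => σ) p)).map_eq using 2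
  ext x i
  by_cases hi : p i
  · simp [hi, MeasurableEquiv.piEquivPiSubtypeProd]
  · simp [hi, MeasurableEquiv.piEquivPiSubtypeProd, ← addRange_addRange_subtype ω x p]

theorem CyclicCondition.map_pi (hcyc : CyclicCondition τ) (hτ : Measurable (uncurry τ))
    (hpush : ∀ ω, σ.map (τ ω) = μ) (ι : Type*) [Fintype ι] (ω : Config X) :
    (Measure.pi fun _ => σ).map (fun (x : ι → X) i => τ (ω.addRange x) (x i)) =
      Measure.pi fun _ => μ := by
  classical
  induction h : Fintype.card ι using Nat.strong_induction_on generalizing ι ω with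
  | _ n ih =>
  cases isEmpty_or_nonempty ι with
  | inl hι =>
    rw [Measure.pi_of_empty, Measure.pi_of_empty _ isEmptyElim, Measure.map_dirac]
    congr
    exact Subsingleton.elim _ _
  | inr hι =>
  refine map_eq_of_forall_map_piecewise_eq (a := fun x i => τ ω (x i))
    (measurable_pi_lambda _ fun i => (hτ.comp measurable_prodMk_left).comp (measurable_pi_apply i))
    ((measurable_addRange_apply hτ).comp (measurable_prodMk_left (x := ω)))
    (fun x => (hcyc.exists_addRange_eq ω x).imp fun _ => Eq.symm) fun S ⟨k, hk⟩ => ?_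
  have hcard : Fintype.card {i // i ∉ S} < n :=
    h ▸ Fintype.card_subtype_lt (x := k) (not_not_intro hk)
  exact map_pi_ite_of_map_pi hτ (hpush ω) fun y => ih _ hcard _ (ω.addRange y) rfl

end Invariance

end Config

section LaplaceTransform

/-- The function `x ↦ e^{-x}` on `[0, ∞]`, with the value `0` at `∞`. Keeping Laplace transforms in
`ℝ≥0∞` avoids all integrability side conditions. -/
noncomputable def expNeg (x : ℝ≥0∞) : ℝ≥0∞ := (EReal.exp x)⁻¹

@[simp]
lemma expNeg_zero : expNeg 0 = 1 := by simp [expNeg]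

lemma expNeg_coe (x : ℝ≥0) : expNeg x = ENNReal.ofReal (Real.exp (-x)) := by
  rw [expNeg, ← EReal.exp_neg, show (-((x : ℝ≥0∞) : EReal)) = ((-x : ℝ) : EReal) from rfl,
    EReal.exp_coe]

lemma expNeg_strictAnti : StrictAnti expNeg := fun _ _ h =>
  ENNReal.inv_lt_inv.2 (EReal.exp_strictMono (EReal.coe_ennreal_lt_coe_ennreal_iff.2 h))

lemma expNeg_le_one (x : ℝ≥0∞) : expNeg x ≤ 1 :=
  expNeg_zero ▸ expNeg_strictAnti.antitone (zero_le (a := x))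

lemma expNeg_ne_top (x : ℝ≥0∞) : expNeg x ≠ ∞ :=
  ((expNeg_le_one x).trans_lt ENNReal.one_lt_top).ne

lemma expNeg_add (x y : ℝ≥0∞) : expNeg (x + y) = expNeg x * expNeg y := by
  have hne (z : ℝ≥0∞) : EReal.exp z ≠ 0 := by simp
  rw [expNeg, EReal.coe_ennreal_add, EReal.exp_add, ENNReal.mul_inv (.inl (hne x)) (.inr (hne y))]
  rfl

lemma expNeg_sum {ι : Type*} (s : Finset ι) (x : ι → ℝ≥0∞) :
    expNeg (∑ i ∈ s, x i) = ∏ i ∈ s, expNeg (x i) := by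
  classical
  induction s using Finset.induction_on with
  | empty => simp
  | insert i s hi ih => rw [Finset.sum_insert hi, Finset.prod_insert hi, expNeg_add, ih]

lemma expNeg_mul_natCast (x : ℝ≥0∞) (n : ℕ) : expNeg (x * n) = expNeg x ^ n := by
  simpa [mul_comm] using expNeg_sum (Finset.range n) fun _ => x

lemma continuous_expNeg : Continuous expNeg :=
  continuous_inv.comp (ENNReal.continuous_exp.comp continuous_coe_ennreal_ereal)

@[fun_prop]
lemma measurable_expNeg : Measurable expNeg := continuous_expNeg.measurable

lemma ext_of_forall_mem_submonoid_integral_eq {E : Type*} [TopologicalSpace E] [PolishSpace E]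
    [MeasurableSpace E] [BorelSpace E] {P P' : Measure E} [IsFiniteMeasure P] [IsFiniteMeasure P']
    (M : Submonoid (E →ᵇ ℝ)) (hM : ∀ x y, x ≠ y → ∃ g ∈ M, g x ≠ g y)
    (h : ∀ g ∈ M, ∫ x, g x ∂P = ∫ x, g x ∂P') : P = P' := by
  let A : StarSubalgebra ℝ (E →ᵇ ℝ) :=
    { Algebra.adjoin ℝ (M : Set (E →ᵇ ℝ)) with
      star_mem' := fun {g} hg => by rwa [show star g = g from rfl] }
  have hA (g : E →ᵇ ℝ) : g ∈ A ↔ g ∈ Submodule.span ℝ (M : Set (E →ᵇ ℝ)) := by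
    change g ∈ Subalgebra.toSubmodule (Algebra.adjoin ℝ (M : Set (E →ᵇ ℝ))) ↔ _
    rw [Algebra.adjoin_eq_span, Submonoid.closure_eq]
  refine ext_of_forall_mem_subalgebra_integral_eq_of_polish (A := A) (fun x y hxy => ?_)
    fun g hg => ?_
  · obtain ⟨g, hgM, hg⟩ := hM x y hxy
    exact ⟨g, ⟨_, ⟨g, (hA g).2 (Submodule.subset_span hgM), rfl⟩, rfl⟩, hg⟩
  · rw [hA] at hg
    induction hg using Submodule.span_induction with
    | mem g hg => exact h g hg
    | zero => simp
    | add f g _ _ ihf ihg =>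
      simp only [BoundedContinuousFunction.coe_add, Pi.add_apply]
      rw [integral_add (f.integrable _) (g.integrable _),
        integral_add (f.integrable _) (g.integrable _), ihf, ihg]
    | smul c g _ ih =>
      simp only [BoundedContinuousFunction.coe_smul]
      rw [integral_smul, integral_smul, ih]

lemma ext_of_lintegral_expNeg {E ι : Type*} [TopologicalSpace E] [PolishSpace E]
    [MeasurableSpace E] [BorelSpace E] [Fintype ι] {P P' : Measure E} [IsFiniteMeasure P]
    [IsFiniteMeasure P'] {φ : ι → E → ℝ≥0∞} (hφ : ∀ i, Continuous (φ i))
    (hinj : Injective fun x i => φ i x)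
    (h : ∀ t : ι → ℝ≥0, ∫⁻ x, expNeg (∑ i, t i * φ i x) ∂P =
      ∫⁻ x, expNeg (∑ i, t i * φ i x) ∂P') : P = P' := by
  classical
  have hcont (t : ι → ℝ≥0) : Continuous fun x => expNeg (∑ i, t i * φ i x) :=
    continuous_expNeg.comp <| continuous_finsetSum _ fun i _ =>
      (ENNReal.continuous_const_mul ENNReal.coe_ne_top).comp (hφ i)
  let M : Submonoid (E →ᵇ ℝ) :=
    { carrier := {g | ∃ t : ι → ℝ≥0, ∀ x, g x = (expNeg (∑ i, t i * φ i x)).toReal}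
      one_mem' := ⟨0, fun x => by simp⟩
      mul_mem' := by
        rintro f g ⟨s, hs⟩ ⟨t, ht⟩
        refine ⟨s + t, fun x => ?_⟩
        simp [hs, ht, add_mul, Finset.sum_add_distrib, expNeg_add] }
  refine ext_of_forall_mem_submonoid_integral_eq M (fun x y hxy => ?_) ?_
  · obtain ⟨i, hi⟩ := Function.ne_iff.1 (hinj.ne hxy)
    let g : E →ᵇ ℝ := .ofNormedAddCommGroup
      (fun x => (expNeg (∑ j, (Pi.single i 1 : ι → ℝ≥0) j * φ j x)).toReal)
      (ENNReal.continuousOn_toReal.comp_continuous (hcont _) fun x => expNeg_ne_top _) 1 fun x => by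
        rw [Real.norm_of_nonneg ENNReal.toReal_nonneg]
        exact ENNReal.toReal_le_of_le_ofReal zero_le_one (by simpa using expNeg_le_one _)
    have hg (x : E) : g x = (expNeg (φ i x)).toReal := by
      change (expNeg (∑ j, (Pi.single i 1 : ι → ℝ≥0) j * φ j x)).toReal = _
      rw [Finset.sum_eq_single i (by simp +contextual) (by simp)]
      simp
    refine ⟨g, ⟨_, fun x => rfl⟩, fun hxy => hi ?_⟩
    rw [hg, hg, ENNReal.toReal_eq_toReal_iff' (expNeg_ne_top _) (expNeg_ne_top _)] at hxy
    exact expNeg_strictAnti.injective hxy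
  · rintro g ⟨t, ht⟩
    have hint (Q : Measure E) : ∫ x, g x ∂Q = (∫⁻ x, expNeg (∑ i, t i * φ i x) ∂Q).toReal := by
      simp only [ht]
      exact integral_toReal (hcont t).measurable.aemeasurable
        (ae_of_all _ fun x => (expNeg_ne_top _).lt_top)
    rw [hint, hint, h]

lemma ext_of_lintegral_expNeg_lintegral {X : Type*} [MeasurableSpace X]
    {Q Q' : Measure (Measure X)} [IsFiniteMeasure Q] [IsFiniteMeasure Q']
    (h : ∀ f : X → ℝ≥0∞, Measurable f →
      ∫⁻ ν, expNeg (∫⁻ x, f x ∂ν) ∂Q = ∫⁻ ν, expNeg (∫⁻ x, f x ∂ν) ∂Q') : Q = Q' := by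
  let Φ (ν : Measure X) (B : {B : Set X // MeasurableSet B}) : ℝ≥0∞ := ν B
  have hΦ : Measurable Φ := measurable_pi_lambda _ fun B => Measure.measurable_coe B.2
  have hrestrict (I : Finset {B : Set X // MeasurableSet B}) :
      (Q.map Φ).map I.restrict = (Q'.map Φ).map I.restrict := by
    have hI : Measurable (I.restrict (π := fun _ => ℝ≥0∞)) := Finset.measurable_restrict I
    rw [Measure.map_map hI hΦ, Measure.map_map hI hΦ]
    refine ext_of_lintegral_expNeg (φ := fun i x => x i) continuous_apply injective_id fun t => ?_
    rw [lintegral_map (by fun_prop) (hI.comp hΦ), lintegral_map (by fun_prop) (hI.comp hΦ)]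
    have hsum (ν : Measure X) : ∑ i, t i * (I.restrict ∘ Φ) ν i =
        ∫⁻ x, ∑ i : I, t i * i.1.1.indicator 1 x ∂ν := by
      rw [lintegral_finsetSum _ fun i _ => by
        exact (measurable_one.indicator i.1.2).const_mul _]
      refine Finset.sum_congr rfl fun i _ => ?_
      rw [lintegral_const_mul _ (measurable_one.indicator i.1.2), lintegral_indicator_one i.1.2]
      rfl
    simp only [hsum]
    exact h _ (Finset.measurable_fun_sum _ fun i _ =>
      (measurable_one.indicator i.1.2).const_mul _)
  have hmap : Q.map Φ = Q'.map Φ :=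
    IsProjectiveLimit.unique (P := fun I => (Q.map Φ).map I.restrict) (fun I => rfl)
      fun I => (hrestrict I).symm
  have hle : Measure.instMeasurableSpace (α := X) ≤ MeasurableSpace.comap Φ inferInstance :=
    iSup₂_le fun B hB => measurable_iff_comap_le.1 <|
      (measurable_pi_apply (⟨B, hB⟩ : {B : Set X // MeasurableSet B})).comp (comap_measurable Φ)
  refine Measure.ext fun S hS => ?_
  obtain ⟨T, hT, rfl⟩ := hle S hS
  rw [← Measure.map_apply hΦ hT, hmap, Measure.map_apply hΦ hT]

lemma Config.ext_of_lintegral_expNeg {X : Type*} [TopologicalSpace X] [MeasurableSpace X]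
    {Q Q' : Measure (Config X)} [IsFiniteMeasure Q] [IsFiniteMeasure Q']
    (h : ∀ f : X → ℝ≥0∞, Measurable f → ∫⁻ ω, expNeg (∫⁻ x, f x ∂ω.toMeasure) ∂Q =
      ∫⁻ ω, expNeg (∫⁻ x, f x ∂ω.toMeasure) ∂Q') : Q = Q' := by
  have hmap : Q.map toMeasure = Q'.map toMeasure := by
    refine ext_of_lintegral_expNeg_lintegral fun f hf => ?_
    have hmeas : Measurable fun ν : Measure X => expNeg (∫⁻ x, f x ∂ν) :=
      measurable_expNeg.comp (Measure.measurable_lintegral hf)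
    rw [lintegral_map hmeas measurable_toMeasure, lintegral_map hmeas measurable_toMeasure, h f hf]
  refine Measure.ext fun S hS => ?_
  obtain ⟨T, hT, rfl⟩ := hS
  rw [← Measure.map_apply measurable_toMeasure hT, hmap, Measure.map_apply measurable_toMeasure hT]

end LaplaceTransform

section Poisson

lemma tsum_poissonMeasure_singleton (r : ℝ≥0) : ∑' n, poissonMeasure r {n} = 1 := by
  simpa using (lintegral_countable' (μ := poissonMeasure r) fun _ => 1).symm

lemma lintegral_pow_poissonMeasure (r : ℝ≥0) {z : ℝ≥0} (hz : z ≤ 1) :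
    ∫⁻ n, (z : ℝ≥0∞) ^ n ∂poissonMeasure r = expNeg ((1 - z) * r) := by
  have hweight (n : ℕ) : (z : ℝ≥0∞) ^ n * poissonMeasure r {n} =
      expNeg ((1 - z) * r) * poissonMeasure (z * r) {n} := by
    rw [show ((1 : ℝ≥0∞) - z) * r = ((1 - z) * r : ℝ≥0) by push_cast; rfl, expNeg_coe,
      poissonMeasure_singleton, poissonMeasure_singleton, ← ENNReal.coe_pow,
      ← ENNReal.ofReal_coe_nnreal, ← ENNReal.ofReal_mul (by positivity),
      ← ENNReal.ofReal_mul (by positivity)]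
    congr 1
    push_cast [NNReal.coe_sub hz]
    rw [show -(r : ℝ) = -((1 - z) * r) + -(z * r) by ring, Real.exp_add]
    ring
  rw [lintegral_countable']
  simp only [hweight]
  rw [ENNReal.tsum_mul_left, tsum_poissonMeasure_singleton, mul_one]

lemma lintegral_expNeg_poissonMeasure (r : ℝ≥0) (s : ℝ≥0∞) :
    ∫⁻ n : ℕ, expNeg (s * n) ∂poissonMeasure r = expNeg ((1 - expNeg s) * r) := by
  obtain ⟨z, hz⟩ := WithTop.ne_top_iff_exists.1 (expNeg_ne_top s)
  change (z : ℝ≥0∞) = expNeg s at hz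
  simp only [expNeg_mul_natCast, ← hz]
  exact lintegral_pow_poissonMeasure r (by exact_mod_cast hz ▸ expNeg_le_one s)

lemma lintegral_natCast_poissonMeasure (r : ℝ≥0) :
    ∫⁻ n : ℕ, (n : ℝ≥0∞) ∂poissonMeasure r = r := by
  have hweight (n : ℕ) : ((n + 1 : ℕ) : ℝ≥0∞) * poissonMeasure r {n + 1} =
      r * poissonMeasure r {n} := by
    rw [poissonMeasure_singleton, poissonMeasure_singleton, ← ENNReal.ofReal_natCast,
      ← ENNReal.ofReal_coe_nnreal, ← ENNReal.ofReal_mul (by positivity),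
      ← ENNReal.ofReal_mul (by positivity), Nat.factorial_succ]
    congr 1
    push_cast
    field_simp
    ring
  rw [lintegral_countable', tsum_eq_zero_add' ENNReal.summable]
  simp only [hweight]
  rw [ENNReal.tsum_mul_left, tsum_poissonMeasure_singleton, Nat.cast_zero, zero_mul, zero_add,
    mul_one]

lemma eq_smul_poissonMeasure_of_lintegral_expNeg {ν : Measure ℕ} {c : ℝ≥0∞} (hc : c ≠ ∞)
    {r : ℝ≥0} (h : ∀ s : ℝ≥0, ∫⁻ n : ℕ, expNeg (s * n) ∂ν = c * expNeg ((1 - expNeg s) * r)) :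
    ν = c • poissonMeasure r := by
  have : IsFiniteMeasure ν := ⟨by simpa using (h 0).trans_lt (by simpa using hc.lt_top)⟩
  have : IsFiniteMeasure (c • poissonMeasure r) := Measure.smul_finite _ hc
  refine ext_of_lintegral_expNeg (ι := Unit) (φ := fun _ n => n)
    (fun _ => continuous_of_discreteTopology) (fun m n hmn => ?_) fun t => ?_
  · simpa using congrFun hmn ()
  · simp only [Finset.univ_unique, Finset.sum_singleton]
    rw [h, lintegral_smul_measure, lintegral_expNeg_poissonMeasure, smul_eq_mul]

end Poisson

lemma isPiSystem_isCompact {X : Type*} [TopologicalSpace X] [T2Space X] :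
    IsPiSystem {K : Set X | IsCompact K} :=
  fun _ hK _ hL _ => IsCompact.inter hK hL

section SigmaCompact

variable {X : Type*} [MetricSpace X] [SigmaCompactSpace X] [MeasurableSpace X] [BorelSpace X]

lemma generateFrom_isCompact :
    ‹MeasurableSpace X› = MeasurableSpace.generateFrom {K : Set X | IsCompact K} := by
  refine le_antisymm ?_ (MeasurableSpace.generateFrom_le fun K hK => IsCompact.measurableSet hK)
  rw [BorelSpace.measurable_eq (α := X), borel_eq_generateFrom_isClosed]
  refine MeasurableSpace.generateFrom_le fun F hF => ?_
  rw [← Set.inter_univ F, ← iUnion_compactCovering, Set.inter_iUnion]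
  exact MeasurableSet.iUnion fun n => MeasurableSpace.measurableSet_generateFrom
    ((isCompact_compactCovering X n).inter_left hF)

lemma exists_monotone_isCompact_measure_diff_eq_zero (σ : Measure X) [IsFiniteMeasureOnCompacts σ]
    {B : Set X} (hB : MeasurableSet B) :
    ∃ K : ℕ → Set X, Monotone K ∧ (∀ n, IsCompact (K n)) ∧ (∀ n, K n ⊆ B) ∧
      σ (B \ ⋃ n, K n) = 0 := by
  have happrox (n : ℕ) : ∃ K, K ⊆ B ∩ compactCovering X n ∧ IsCompact K ∧
      σ ((B ∩ compactCovering X n) \ K) < (n + 1 : ℝ≥0∞)⁻¹ := by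
    have hcov := isCompact_compactCovering X n
    have : IsFiniteMeasure (σ.restrict (compactCovering X n)) :=
      ⟨by simpa using hcov.measure_lt_top⟩
    obtain ⟨K, hKB, hK, hlt⟩ := (hB.inter hcov.measurableSet).exists_isCompact_sdiff_lt
      (μ := σ.restrict (compactCovering X n)) (measure_ne_top _ _)
      (ENNReal.inv_ne_zero.2 (by finiteness : (n + 1 : ℝ≥0∞) ≠ ∞))
    refine ⟨K, hKB, hK, ?_⟩
    rwa [Measure.restrict_eq_self _ (Set.sdiff_subset.trans Set.inter_subset_right)] at hlt
  choose K hKB hK hlt using happrox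
  refine ⟨Set.accumulate K, Set.monotone_accumulate, isCompact_accumulate hK,
    fun n => Set.iUnion₂_subset fun m _ => (hKB m).trans Set.inter_subset_left, ?_⟩
  rw [Set.iUnion_accumulate, ← Set.inter_univ B, ← iUnion_compactCovering X, Set.inter_iUnion,
    Set.iUnion_sdiff, measure_iUnion_null_iff]
  intro m
  refine le_antisymm (ENNReal.le_of_forall_pos_le_add fun ε hε _ => ?_) zero_le
  obtain ⟨n, hn⟩ := ENNReal.exists_inv_nat_lt (ENNReal.coe_ne_zero.2 hε.ne')
  calc σ ((B ∩ compactCovering X m) \ ⋃ i, K i)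
      ≤ σ ((B ∩ compactCovering X (max m n)) \ K (max m n)) := measure_mono <|
        Set.sdiff_subset_sdiff (Set.inter_subset_inter_right _ <|
          compactCovering_subset X (le_max_left m n)) (Set.subset_iUnion K _)
    _ ≤ (n : ℝ≥0∞)⁻¹ := (hlt _).le.trans <| ENNReal.inv_le_inv.2 <| by
        exact_mod_cast (le_max_right m n).trans (Nat.le_succ _)
    _ ≤ 0 + ε := by simpa using hn.le

end SigmaCompact

lemma apply_sum_indicator_of_pairwise_disjoint {ι X M N : Type*} [Fintype ι] [AddCommMonoid M]
    [AddCommMonoid N] {A : ι → Set X} (hA : Pairwise (Disjoint on A)) {F : M → N} (hF : F 0 = 0)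
    (t : ι → M) (x : X) :
    F (∑ i, (A i).indicator (fun _ => t i) x) = ∑ i, (A i).indicator (fun _ => F (t i)) x := by
  by_cases hx : ∃ i, x ∈ A i
  · obtain ⟨i, hi⟩ := hx
    have hne (j : ι) (hj : j ≠ i) : x ∉ A j := fun hxj => (hA hj).ne_of_mem hxj hi rfl
    rw [Finset.sum_eq_single i (fun j _ hj => Set.indicator_of_notMem (hne j hj) _) (by simp),
      Finset.sum_eq_single i (fun j _ hj => Set.indicator_of_notMem (hne j hj) _) (by simp),
      Set.indicator_of_mem hi, Set.indicator_of_mem hi]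
  · push Not at hx
    simp [hx, hF]

lemma lintegral_one_sub_expNeg_sum_indicator {ι X : Type*} [Fintype ι] [MeasurableSpace X]
    {σ : Measure X} {A : ι → Set X} (hA : ∀ i, MeasurableSet (A i))
    (hdisj : Pairwise (Disjoint on A)) (t : ι → ℝ≥0∞) :
    ∫⁻ x, (1 - expNeg (∑ i, (A i).indicator (fun _ => t i) x)) ∂σ =
      ∑ i, (1 - expNeg (t i)) * σ (A i) := by
  have hind (x : X) := apply_sum_indicator_of_pairwise_disjoint hdisj
    (F := fun s => 1 - expNeg s) (by simp) t x
  simp only [hind]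
  rw [lintegral_finsetSum _ fun i _ => measurable_const.indicator (hA i)]
  exact Finset.sum_congr rfl fun i _ => lintegral_indicator_const (hA i) _

lemma expNeg_iSup {ι : Type*} [Nonempty ι] (a : ι → ℝ≥0∞) :
    expNeg (⨆ i, a i) = ⨅ i, expNeg (a i) :=
  expNeg_strictAnti.antitone.map_ciSup_of_continuousAt continuous_expNeg.continuousAt

namespace Config

section Laplace

variable {X : Type*} [MetricSpace X] [SigmaCompactSpace X] [MeasurableSpace X] [BorelSpace X]

/-- The Laplace functional of `P` takes at `f` the value which it has for the Poisson measure with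
intensity `σ`. -/
def LaplaceIdentity {X : Type*} [TopologicalSpace X] [MeasurableSpace X] (σ : Measure X)
    (P : Measure (Config X)) (f : X → ℝ≥0∞) : Prop :=
  ∫⁻ ω, expNeg (∫⁻ x, f x ∂ω.toMeasure) ∂P = expNeg (∫⁻ x, (1 - expNeg (f x)) ∂σ)

lemma measurable_expNeg_lintegral_toMeasure {f : X → ℝ≥0∞} (hf : Measurable f) :
    Measurable fun ω : Config X => expNeg (∫⁻ x, f x ∂ω.toMeasure) :=
  measurable_expNeg.comp (measurable_lintegral_toMeasure measurable_id (by fun_prop))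

variable {σ : Measure X} {P : Measure (Config X)}

lemma LaplaceIdentity.iSup [IsFiniteMeasure P] {f : ℕ → X → ℝ≥0∞} (hf : ∀ n, Measurable (f n))
    (hmono : Monotone f) (h : ∀ n, LaplaceIdentity σ P (f n)) :
    LaplaceIdentity σ P fun x => ⨆ n, f n x := by
  have hLaplace : ∫⁻ ω, expNeg (∫⁻ x, ⨆ n, f n x ∂ω.toMeasure) ∂P =
      ⨅ n, ∫⁻ ω, expNeg (∫⁻ x, f n x ∂ω.toMeasure) ∂P := by
    simp only [lintegral_iSup hf hmono, expNeg_iSup]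
    refine lintegral_iInf (fun n => measurable_expNeg_lintegral_toMeasure (hf n))
      (fun m n hmn ω => expNeg_strictAnti.antitone (lintegral_mono (hmono hmn))) (ne_of_lt ?_)
    calc ∫⁻ ω, expNeg (∫⁻ x, f 0 x ∂ω.toMeasure) ∂P ≤ ∫⁻ _, 1 ∂P :=
        lintegral_mono fun _ => expNeg_le_one _
      _ < ∞ := by simp
  have hexponent : ∫⁻ x, (1 - expNeg (⨆ n, f n x)) ∂σ =
      ⨆ n, ∫⁻ x, (1 - expNeg (f n x)) ∂σ := by
    simp only [expNeg_iSup, ENNReal.sub_iInf]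
    exact lintegral_iSup (fun n => by fun_prop) fun m n hmn x =>
      tsub_le_tsub_left (expNeg_strictAnti.antitone (hmono hmn x)) 1
  rw [LaplaceIdentity, hLaplace, hexponent, expNeg_iSup]
  exact iInf_congr h

variable [IsFiniteMeasureOnCompacts σ]

lemma IsPoissonMeasure.lintegral_toMeasure_apply (hP : IsPoissonMeasure σ P) {B : Set X}
    (hB : MeasurableSet B) : ∫⁻ ω, ω.toMeasure B ∂P = σ B := by
  have hbind : P.bind toMeasure = σ := by
    refine (Measure.ext_of_generateFrom_of_iUnion _ (compactCovering X) generateFrom_isCompact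
      isPiSystem_isCompact (iUnion_compactCovering X) (isCompact_compactCovering X)
      (fun n => (isCompact_compactCovering X n).measure_ne_top) fun K (hK : IsCompact K) => ?_).symm
    rw [Measure.bind_apply hK.measurableSet measurable_toMeasure.aemeasurable]
    simp only [toMeasure_apply_of_isCompact hK]
    rw [(hP.hasLaw_count K hK).lintegral_comp (f := fun n : ℕ => (n : ℝ≥0∞)) (by fun_prop),
      lintegral_natCast_poissonMeasure, ENNReal.coe_toNNReal hK.measure_ne_top]
  rw [← Measure.bind_apply hB measurable_toMeasure.aemeasurable, hbind]

lemma IsPoissonMeasure.laplaceIdentity_congr (hP : IsPoissonMeasure σ P) {f g : X → ℝ≥0∞}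
    (hf : Measurable f) (hg : Measurable g) (hfg : f =ᵐ[σ] g) (h : LaplaceIdentity σ P f) :
    LaplaceIdentity σ P g := by
  have hne : MeasurableSet {x | f x ≠ g x} := (measurableSet_eq_fun hf hg).compl
  have hnull : ∀ᵐ ω ∂P, ω.toMeasure {x | f x ≠ g x} = 0 := by
    refine (lintegral_eq_zero_iff ((Measure.measurable_coe hne).comp measurable_toMeasure)).1 ?_
    exact (hP.lintegral_toMeasure_apply hne).trans hfg
  have hLaplace : ∫⁻ ω, expNeg (∫⁻ x, f x ∂ω.toMeasure) ∂P =
      ∫⁻ ω, expNeg (∫⁻ x, g x ∂ω.toMeasure) ∂P :=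
    lintegral_congr_ae <| hnull.mono fun ω hω => by
      simp only [lintegral_congr_ae (show f =ᵐ[ω.toMeasure] g from hω)]
  have hexponent : ∫⁻ x, (1 - expNeg (f x)) ∂σ = ∫⁻ x, (1 - expNeg (g x)) ∂σ :=
    lintegral_congr_ae (hfg.mono fun x hx => by simp only [hx])
  rw [LaplaceIdentity, ← hLaplace, h, hexponent]

lemma lintegral_toMeasure_sum_indicator {ι : Type*} [Fintype ι] {A : ι → Set X}
    (hA : ∀ i, IsCompact (A i)) (t : ι → ℝ≥0∞) (ω : Config X) :
    ∫⁻ x, ∑ i, (A i).indicator (fun _ => t i) x ∂ω.toMeasure = ∑ i, t i * count (A i) ω := by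
  rw [lintegral_finsetSum _ fun i _ => measurable_const.indicator (hA i).measurableSet]
  refine Finset.sum_congr rfl fun i _ => ?_
  rw [lintegral_indicator_const (hA i).measurableSet, toMeasure_apply_of_isCompact (hA i)]

lemma IsPoissonMeasure.laplaceIdentity_sum_indicator_of_isCompact (hP : IsPoissonMeasure σ P)
    {n : ℕ} {A : Fin n → Set X} (hA : ∀ i, IsCompact (A i)) (hdisj : Pairwise (Disjoint on A))
    (t : Fin n → ℝ≥0∞) :
    LaplaceIdentity σ P fun x => ∑ i, (A i).indicator (fun _ => t i) x := by
  have hindep : iIndepFun (fun i ω => expNeg (t i * count (A i) ω)) P :=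
    (hP.iIndepFun_count n A hA hdisj).comp (fun i m => expNeg (t i * m)) fun i => by fun_prop
  have hmeas (i : Fin n) : Measurable fun ω => expNeg (t i * count (A i) ω) :=
    (measurable_of_countable fun m : ℕ => expNeg (t i * m)).comp (measurable_count (hA i))
  rw [LaplaceIdentity, lintegral_one_sub_expNeg_sum_indicator (fun i => (hA i).measurableSet) hdisj]
  simp only [lintegral_toMeasure_sum_indicator hA, expNeg_sum]
  rw [lintegral_prod_eq_prod_lintegral_of_indepFun _ _ hindep hmeas]
  refine Finset.prod_congr rfl fun i _ => ?_
  rw [(hP.hasLaw_count _ (hA i)).lintegral_comp (f := fun m : ℕ => expNeg (t i * m))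
    (by fun_prop), lintegral_expNeg_poissonMeasure, ENNReal.coe_toNNReal (hA i).measure_ne_top]

lemma IsPoissonMeasure.laplaceIdentity_sum_indicator (hP : IsPoissonMeasure σ P)
    {n : ℕ} {B : Fin n → Set X} (hB : ∀ i, MeasurableSet (B i)) (hdisj : Pairwise (Disjoint on B))
    (t : Fin n → ℝ≥0∞) :
    LaplaceIdentity σ P fun x => ∑ i, (B i).indicator (fun _ => t i) x := by
  have := hP.isProbabilityMeasure
  choose K hmono hK hKB hnull using
    fun i => exists_monotone_isCompact_measure_diff_eq_zero σ (hB i)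
  let f (m : ℕ) (x : X) : ℝ≥0∞ := ∑ i, (K i m).indicator (fun _ => t i) x
  have hf (m : ℕ) : Measurable (f m) := Finset.measurable_fun_sum _ fun i _ =>
    measurable_const.indicator (hK i m).measurableSet
  have hfmono : Monotone f := fun m m' hm x => Finset.sum_le_sum fun i _ =>
    Set.indicator_le_indicator_of_subset (hmono i hm) (fun _ => zero_le) x
  refine hP.laplaceIdentity_congr (.iSup hf) (Finset.measurable_fun_sum _ fun i _ =>
    measurable_const.indicator (hB i)) ?_ <| LaplaceIdentity.iSup hf hfmono fun m =>
      hP.laplaceIdentity_sum_indicator_of_isCompact (fun i => hK i m)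
        (fun i j hij => (hdisj hij).mono (hKB i m) (hKB j m)) t
  have hae : ∀ᵐ x ∂σ, ∀ i, x ∉ B i \ ⋃ m, K i m :=
    ae_all_iff.2 fun i => measure_eq_zero_iff_ae_notMem.1 (hnull i)
  filter_upwards [hae] with x hx
  simp only [f]
  rw [← ENNReal.finsetSum_iSup_of_monotone
    (f := fun i m => (K i m).indicator (fun _ => t i) x) fun i m m' hm =>
      Set.indicator_le_indicator_of_subset (hmono i hm) (fun _ => zero_le) x]
  refine Finset.sum_congr rfl fun i _ => ?_
  rw [← Set.indicator_iUnion_apply bot_eq_zero]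
  by_cases hxB : x ∈ B i
  · have hxK : x ∈ ⋃ m, K i m := by_contra fun hxK => hx i ⟨hxB, hxK⟩
    rw [Set.indicator_of_mem hxK, Set.indicator_of_mem hxB]
  · have hxK : x ∉ ⋃ m, K i m := fun hxK => hxB (Set.iUnion_subset (hKB i) hxK)
    rw [Set.indicator_of_notMem hxK, Set.indicator_of_notMem hxB]

lemma IsPoissonMeasure.laplaceIdentity (hP : IsPoissonMeasure σ P) {f : X → ℝ≥0∞}
    (hf : Measurable f) : LaplaceIdentity σ P f := by
  have := hP.isProbabilityMeasure
  have hsimple (g : SimpleFunc X ℝ≥0∞) : LaplaceIdentity σ P g := by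
    let c (i : Fin g.range.card) : ℝ≥0∞ := g.range.equivFin.symm i
    have hc : Injective c := Subtype.val_injective.comp (Equiv.injective _)
    have hg (x : X) : g x = ∑ i, (g ⁻¹' {c i}).indicator (fun _ => c i) x := by
      rw [Finset.sum_eq_single (g.range.equivFin ⟨g x, g.mem_range_self x⟩)]
      · simp [c]
      · intro i _ hi
        refine Set.indicator_of_notMem (fun hx => hi ?_) _
        exact (Equiv.symm_apply_eq _).1 (Subtype.ext (Eq.symm hx))
      · simp
    rw [show ⇑g = _ from funext hg]
    exact hP.laplaceIdentity_sum_indicator (fun i => g.measurableSet_fiber _)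
      (fun i j hij => Disjoint.preimage _ (Set.disjoint_singleton.2 (hc.ne hij))) c
  have hsup : f = fun x => ⨆ n, SimpleFunc.eapprox f n x :=
    funext fun x => (SimpleFunc.iSup_eapprox_apply hf x).symm
  rw [hsup]
  exact .iSup (fun n => (SimpleFunc.eapprox f n).measurable)
    (fun m n hmn => SimpleFunc.monotone_eapprox f hmn) fun n => hsimple _

lemma IsPoissonMeasure.unique {P' : Measure (Config X)} (hP : IsPoissonMeasure σ P)
    (hP' : IsPoissonMeasure σ P') : P = P' := by
  have := hP.isProbabilityMeasure
  have := hP'.isProbabilityMeasure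
  exact Config.ext_of_lintegral_expNeg fun f hf =>
    (hP.laplaceIdentity hf).trans (hP'.laplaceIdentity hf).symm

end Laplace

section Mecke

variable {X : Type*} [MetricSpace X] [SigmaCompactSpace X] [MeasurableSpace X] [BorelSpace X]
  {σ : Measure X} [IsFiniteMeasureOnCompacts σ] {P : Measure (Config X)}

lemma IsPoissonMeasure.lintegral_expNeg_mul_expNeg_count (hP : IsPoissonMeasure σ P)
    {f : X → ℝ≥0∞} (hf : Measurable f) {K : Set X} (hK : IsCompact K) (s : ℝ≥0) :
    ∫⁻ ω, expNeg (∫⁻ x, f x ∂ω.toMeasure) * expNeg (s * count K ω) ∂P =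
      (∫⁻ ω, expNeg (∫⁻ x, f x ∂ω.toMeasure) ∂P) *
        expNeg ((1 - expNeg s) * ∫⁻ x in K, expNeg (f x) ∂σ) := by
  have hs : Measurable (K.indicator fun _ => (s : ℝ≥0∞)) :=
    measurable_const.indicator hK.measurableSet
  have hcombine (ω : Config X) : expNeg (∫⁻ x, f x ∂ω.toMeasure) * expNeg (s * count K ω) =
      expNeg (∫⁻ x, f x + K.indicator (fun _ => (s : ℝ≥0∞)) x ∂ω.toMeasure) := by
    rw [lintegral_add_left hf, lintegral_indicator_const hK.measurableSet,
      toMeasure_apply_of_isCompact hK, expNeg_add]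
  have hexponent (x : X) : 1 - expNeg (f x + K.indicator (fun _ => (s : ℝ≥0∞)) x) =
      (1 - expNeg (f x)) + (1 - expNeg s) * K.indicator (fun x => expNeg (f x)) x := by
    by_cases hx : x ∈ K
    · have hle : expNeg s * expNeg (f x) ≤ expNeg (f x) := mul_le_of_le_one_left' (expNeg_le_one _)
      rw [Set.indicator_of_mem hx, Set.indicator_of_mem hx, expNeg_add,
        ENNReal.sub_mul fun _ _ => expNeg_ne_top _, one_mul, mul_comm (expNeg (f x)),
        tsub_add_tsub_cancel (expNeg_le_one _) hle]
    · simp [hx]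
  have hL := hP.laplaceIdentity (hf.add hs)
  simp only [LaplaceIdentity, Pi.add_apply] at hL
  simp only [hcombine]
  rw [hL, (hP.laplaceIdentity hf : _ = _)]
  simp only [hexponent]
  have hexp : Measurable fun x => expNeg (f x) := by fun_prop
  rw [lintegral_add_left (by fun_prop), lintegral_const_mul _ (hexp.indicator hK.measurableSet),
    lintegral_indicator hK.measurableSet, expNeg_add]

lemma IsPoissonMeasure.lintegral_expNeg_mul_count (hP : IsPoissonMeasure σ P) {f : X → ℝ≥0∞}
    (hf : Measurable f) {K : Set X} (hK : IsCompact K) :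
    ∫⁻ ω, expNeg (∫⁻ x, f x ∂ω.toMeasure) * count K ω ∂P =
      (∫⁻ ω, expNeg (∫⁻ x, f x ∂ω.toMeasure) ∂P) * ∫⁻ x in K, expNeg (f x) ∂σ := by
  have := hP.isProbabilityMeasure
  set c := ∫⁻ ω, expNeg (∫⁻ x, f x ∂ω.toMeasure) ∂P with hc
  set b := ∫⁻ x in K, expNeg (f x) ∂σ
  have hc_top : c ≠ ∞ := by
    rw [hc, (hP.laplaceIdentity hf : _ = _)]
    exact expNeg_ne_top _
  have hb_top : b ≠ ∞ := ne_of_lt <| calc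
    b ≤ ∫⁻ _ in K, 1 ∂σ := lintegral_mono fun _ => expNeg_le_one _
    _ < ∞ := by simpa using hK.measure_lt_top
  have hdens := measurable_expNeg_lintegral_toMeasure hf
  have hcount := measurable_count hK
  -- Under the weight `e^{-ω(f)}` the variable `ω(K)` is again Poisson, of parameter `b`.
  have hlaw : (P.withDensity fun ω => expNeg (∫⁻ x, f x ∂ω.toMeasure)).map (count K) =
      c • poissonMeasure b.toNNReal := by
    refine eq_smul_poissonMeasure_of_lintegral_expNeg hc_top fun s => ?_
    have hexp : Measurable fun ω => expNeg (s * count K ω) :=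
      (measurable_of_countable fun n : ℕ => expNeg (s * n)).comp hcount
    rw [lintegral_map (by fun_prop) hcount, lintegral_withDensity_eq_lintegral_mul _ hdens hexp,
      ENNReal.coe_toNNReal hb_top]
    exact hP.lintegral_expNeg_mul_expNeg_count hf hK s
  calc ∫⁻ ω, expNeg (∫⁻ x, f x ∂ω.toMeasure) * count K ω ∂P
      = ∫⁻ n : ℕ, n ∂(P.withDensity fun ω => expNeg (∫⁻ x, f x ∂ω.toMeasure)).map (count K) := by
        have hcast : Measurable fun ω => (count K ω : ℝ≥0∞) :=
          (measurable_of_countable fun n : ℕ => (n : ℝ≥0∞)).comp hcount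
        rw [lintegral_map (by fun_prop) hcount,
          lintegral_withDensity_eq_lintegral_mul _ hdens hcast]
        rfl
    _ = c * b := by
        rw [hlaw, lintegral_smul_measure, lintegral_natCast_poissonMeasure,
          ENNReal.coe_toNNReal hb_top, smul_eq_mul]

variable [NullSingletonClass σ]

lemma IsPoissonMeasure.ae_notMem (hP : IsPoissonMeasure σ P) (x : X) :
    ∀ᵐ ω ∂P, x ∉ ω.carrier := by
  have hmean : ∫⁻ ω, ω.toMeasure {x} ∂P = 0 := by
    rw [hP.lintegral_toMeasure_apply (measurableSet_singleton x), measure_singleton]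
  have hae := (lintegral_eq_zero_iff
    ((Measure.measurable_coe (measurableSet_singleton x)).comp measurable_toMeasure)).1 hmean
  filter_upwards [hae] with ω hω hx
  simp [toMeasure_apply ω (measurableSet_singleton x), Set.inter_singleton_of_mem hx] at hω

lemma IsPoissonMeasure.withDensity_count (hP : IsPoissonMeasure σ P) {K : Set X}
    (hK : IsCompact K) :
    P.withDensity (fun ω => (count K ω : ℝ≥0∞)) =
      (P.prod (σ.restrict K)).map fun p => p.1.add p.2 := by
  have := hP.isProbabilityMeasure
  have : IsFiniteMeasure (σ.restrict K) := ⟨by simpa using hK.measure_lt_top⟩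
  have hcount : Measurable fun ω : Config X => (count K ω : ℝ≥0∞) :=
    (measurable_of_countable fun n : ℕ => (n : ℝ≥0∞)).comp (measurable_count hK)
  have : IsFiniteMeasure (P.withDensity fun ω => (count K ω : ℝ≥0∞)) := by
    refine isFiniteMeasure_withDensity ?_
    simp only [← toMeasure_apply_of_isCompact hK]
    rw [hP.lintegral_toMeasure_apply hK.measurableSet]
    exact hK.measure_ne_top
  have := Measure.isFiniteMeasure_map (P.prod (σ.restrict K)) fun p => p.1.add p.2
  refine Config.ext_of_lintegral_expNeg fun f hf => ?_
  have hgen := measurable_expNeg_lintegral_toMeasure hf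
  have hadd (x : X) : ∫⁻ ω, expNeg (∫⁻ y, f y ∂(ω.add x).toMeasure) ∂P =
      (∫⁻ ω, expNeg (∫⁻ y, f y ∂ω.toMeasure) ∂P) * expNeg (f x) := by
    rw [← lintegral_mul_const _ hgen]
    refine lintegral_congr_ae ((hP.ae_notMem x).mono fun ω hω => ?_)
    simp only [toMeasure_add hω, lintegral_add_measure, lintegral_dirac, expNeg_add]
  have hgen_add : Measurable fun p : Config X × X =>
      expNeg (∫⁻ y, f y ∂(p.1.add p.2).toMeasure) := hgen.comp measurable_add
  rw [lintegral_withDensity_eq_lintegral_mul _ hcount hgen, lintegral_map hgen measurable_add,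
    lintegral_prod_symm' _ hgen_add]
  simp only [Pi.mul_apply, hadd]
  rw [lintegral_const_mul _ (by fun_prop), ← hP.lintegral_expNeg_mul_count hf hK]
  exact lintegral_congr fun ω => mul_comm _ _

lemma IsPoissonMeasure.compProd_pointKernel (hP : IsPoissonMeasure σ P) :
    P ⊗ₘ pointKernel X = (P.prod σ).map fun p => (p.1.add p.2, p.2) := by
  have := hP.isProbabilityMeasure
  have hcov := isCompact_compactCovering X
  have hadd : Measurable fun p : Config X × X => (p.1.add p.2, p.2) :=
    measurable_add.prodMk measurable_snd
  refine Measure.ext_of_generateFrom_of_iUnion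
    (Set.image2 (· ×ˢ ·) {C : Set (Config X) | MeasurableSet C} {K : Set X | IsCompact K})
    (fun n => Set.univ ×ˢ compactCovering X n) ?_
    (MeasurableSpace.isPiSystem_measurableSet.prod isPiSystem_isCompact) ?_
    (fun n => ⟨_, Set.mem_ofPred.2 .univ, _, hcov n, rfl⟩) (fun n => ?_) ?_
  · exact (generateFrom_eq_prod MeasurableSpace.generateFrom_measurableSet
      generateFrom_isCompact.symm
      ⟨fun _ => Set.univ, fun _ => Set.mem_ofPred.2 .univ, Set.iUnion_const _⟩
      ⟨compactCovering X, hcov, iUnion_compactCovering X⟩).symm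
  · rw [← Set.prod_iUnion, iUnion_compactCovering, Set.univ_prod_univ]
  · rw [Measure.compProd_apply_prod .univ (hcov n).measurableSet, Measure.restrict_univ]
    exact (hP.lintegral_toMeasure_apply (hcov n).measurableSet).trans_ne (hcov n).measure_ne_top
  · rintro _ ⟨C, hC : MeasurableSet C, K, hK : IsCompact K, rfl⟩
    calc (P ⊗ₘ pointKernel X) (C ×ˢ K)
        = (P.withDensity fun ω => (count K ω : ℝ≥0∞)) C := by
          rw [Measure.compProd_apply_prod hC hK.measurableSet, withDensity_apply _ hC]
          exact lintegral_congr fun ω => toMeasure_apply_of_isCompact hK ω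
      _ = (P.prod σ) ((fun p => p.1.add p.2) ⁻¹' C ∩ Set.univ ×ˢ K) := by
          rw [hP.withDensity_count hK, Measure.map_apply measurable_add hC,
            ← Measure.restrict_apply (measurable_add hC), ← Measure.prod_restrict,
            Measure.restrict_univ]
      _ = ((P.prod σ).map fun p => (p.1.add p.2, p.2)) (C ×ˢ K) := by
          rw [Measure.map_apply hadd (hC.prod hK.measurableSet)]
          congr 1
          ext ⟨ω, x⟩
          simp

theorem IsPoissonMeasure.mecke_formula (hP : IsPoissonMeasure σ P)
    {F : Config X → X → ℝ≥0∞} (hF : Measurable (uncurry F)) :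
    ∫⁻ ω, ∫⁻ x, F ω x ∂ω.toMeasure ∂P = ∫⁻ ω, ∫⁻ x, F (ω.add x) x ∂σ ∂P := by
  have := hP.isProbabilityMeasure
  have hadd : Measurable fun p : Config X × X => (p.1.add p.2, p.2) :=
    measurable_add.prodMk measurable_snd
  calc ∫⁻ ω, ∫⁻ x, F ω x ∂ω.toMeasure ∂P
      = ∫⁻ p, uncurry F p ∂(P ⊗ₘ pointKernel X) :=
        (Measure.lintegral_compProd (μ := P) (κ := pointKernel X) hF).symm
    _ = ∫⁻ ω, ∫⁻ x, F (ω.add x) x ∂σ ∂P := by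
        rw [hP.compProd_pointKernel, lintegral_map hF hadd]
        exact lintegral_prod _ (hF.comp hadd).aemeasurable

end Mecke

end Config

section Embeddings

variable {α : Type*} {n : ℕ}

open Set.powersetCard in
lemma card_ofFinEmb_fiber (T : Set.powersetCard α n) :
    ENat.card {e // ofFinEmb n α e = T} = n.factorial := by
  let fiberEquiv : {e // ofFinEmb n α e = T} ≃ (Fin n ↪ T.1) :=
    { toFun e := e.1.codRestrict T.1 fun i => by simp [← e.2]
      invFun e := ⟨e.trans (.subtype (· ∈ T.1)), Subtype.ext <| by
        refine Finset.eq_of_subset_of_card_le (fun x => ?_) (by simp)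
        simp only [val_ofFinEmb, Finset.mem_map]
        rintro ⟨i, -, rfl⟩
        exact (e i).2⟩
      left_inv _ := rfl
      right_inv _ := rfl }
  rw [ENat.card_congr fiberEquiv, ENat.card_eq_coe_fintype_card, Fintype.card_embedding_eq,
    Fintype.card_coe, Fintype.card_fin, T.2, Nat.descFactorial_self]

open Set.powersetCard in
lemma tsum_embedding_prod (g : α → ℝ≥0∞) :
    ∑' e : Fin n ↪ α, ∏ i, g (e i) =
      n.factorial * ∑' T : Set.powersetCard α n, ∏ x ∈ T.1, g x := by
  have hconst (T : Set.powersetCard α n) (e : {e // ofFinEmb n α e = T}) :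
      ∏ i, g (e.1 i) = ∏ x ∈ T.1, g x := by
    obtain ⟨e, rfl⟩ := e
    simp
  rw [← (Equiv.sigmaFiberEquiv (ofFinEmb n α)).tsum_eq, ENNReal.tsum_sigma',
    ← ENNReal.tsum_mul_left]
  simp only [Equiv.sigmaFiberEquiv_apply, hconst, ENNReal.tsum_const, card_ofFinEmb_fiber,
    ENat.toENNReal_coe]

lemma tsum_embedding_prod_of_support_subset {g : α → ℝ≥0∞} {S : Finset α} (hS : support g ⊆ S) :
    ∑' e : Fin n ↪ α, ∏ i, g (e i) = n.factorial * ∑ T ∈ S.powersetCard n, ∏ x ∈ T, g x := by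
  rw [tsum_embedding_prod, tsum_subtype (Set.powersetCard α n) fun T => ∏ x ∈ T, g x,
    tsum_eq_sum fun T hT => ?_]
  · congr 1
    refine Finset.sum_congr rfl fun T hT => Set.indicator_of_mem ?_ _
    exact Set.powersetCard.mem_iff.2 (Finset.mem_powersetCard.1 hT).2
  · refine Set.indicator_apply_eq_zero.2 fun hcard => ?_
    have hTS : ¬ T ⊆ S := fun h => hT (Finset.mem_powersetCard.2 ⟨h, hcard⟩)
    obtain ⟨x, hx, hxS⟩ := Finset.not_subset.1 hTS
    exact Finset.prod_eq_zero hx (notMem_support.1 fun h => hxS (hS h))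

lemma hasSum_neg_one_pow_div_factorial_mul_tsum_embedding {f : α → ℝ≥0∞}
    (hf : (support f).Finite) :
    HasSum (fun n : ℕ => (-1) ^ n / n.factorial *
      (∑' e : Fin n ↪ α, ∏ i, (1 - expNeg (f (e i)))).toReal) (expNeg (∑' x, f x)).toReal := by
  obtain ⟨S, hS⟩ := hf.exists_finset_coe
  have hsupp : support (fun x => 1 - expNeg (f x)) ⊆ S := by
    rw [hS]
    exact support_subset_iff'.2 fun x hx => by simp [notMem_support.1 hx]
  have hterm (n : ℕ) : (-1) ^ n / n.factorial *
      (∑' e : Fin n ↪ α, ∏ i, (1 - expNeg (f (e i)))).toReal =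
        ∑ T ∈ S.powersetCard n, ∏ x ∈ T, ((expNeg (f x)).toReal - 1) := by
    have hn : (n.factorial : ℝ) ≠ 0 := by positivity
    have hfin (T : Finset α) : ∏ x ∈ T, (1 - expNeg (f x)) ≠ ∞ :=
      ENNReal.prod_ne_top fun x _ => ENNReal.sub_ne_top ENNReal.one_ne_top
    rw [tsum_embedding_prod_of_support_subset hsupp, ENNReal.toReal_mul, ENNReal.toReal_natCast,
      ENNReal.toReal_sum fun T _ => hfin T, ← mul_assoc, div_mul_cancel₀ _ hn, Finset.mul_sum]
    refine Finset.sum_congr rfl fun T hT => ?_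
    rw [← (Finset.mem_powersetCard.1 hT).2, ENNReal.toReal_prod, ← Finset.prod_neg]
    refine Finset.prod_congr rfl fun x _ => ?_
    rw [ENNReal.toReal_sub_of_le (expNeg_le_one _) ENNReal.one_ne_top, ENNReal.toReal_one, neg_sub]
  have hprod : (expNeg (∑' x, f x)).toReal =
      ∑ n ∈ Finset.range (S.card + 1), ∑ T ∈ S.powersetCard n,
        ∏ x ∈ T, ((expNeg (f x)).toReal - 1) := by
    rw [tsum_eq_sum (s := S) fun x hx => notMem_support.1 fun h => hx (by simpa [← hS] using h),
      expNeg_sum, ENNReal.toReal_prod, ← Finset.sum_powerset, ← Finset.prod_one_add]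
    simp
  simp only [hterm, hprod]
  refine hasSum_sum_of_ne_finset_zero fun n hn => ?_
  rw [Finset.powersetCard_eq_empty.2 (by simpa [Nat.lt_succ_iff] using hn), Finset.sum_empty]

end Embeddings

lemma measurable_finCons {α E : Type*} [MeasurableSpace α] [MeasurableSpace E] {n : ℕ}
    {y : α → E} (hy : Measurable y) {x : α → Fin n → E} (hx : Measurable x) :
    Measurable fun a => (Fin.cons (y a) (x a) : Fin (n + 1) → E) :=
  measurable_pi_lambda _ <| Fin.cases hy (measurable_pi_iff.1 hx)

lemma lintegral_pi_fin_succ {E : Type*} [MeasurableSpace E] (ν : Measure E) [SigmaFinite ν]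
    {n : ℕ} {G : (Fin (n + 1) → E) → ℝ≥0∞} (hG : Measurable G) :
    ∫⁻ x, G x ∂(Measure.pi fun _ => ν) =
      ∫⁻ x, ∫⁻ y, G (Fin.cons y x) ∂ν ∂(Measure.pi fun _ : Fin n => ν) := by
  have hmp := (measurePreserving_piFinSuccAbove (fun _ : Fin (n + 1) => ν) 0).symm
  have hcons : Measurable fun p : E × (Fin n → E) => G (Fin.cons p.1 p.2) :=
    hG.comp (measurable_finCons measurable_fst measurable_snd)
  rw [← hmp.lintegral_comp hG, ← lintegral_prod_symm _ hcons.aemeasurable]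
  simp only [MeasurableEquiv.piFinSuccAbove_symm_apply, Fin.insertNthEquiv, Equiv.coe_fn_mk,
    Fin.insertNth_zero']

namespace Config

/-- The sum of `K` over the `n`-tuples of distinct points of `ω`, that is, the integral of `K`
against the `n`-th factorial power of the point measure of `ω`. -/
noncomputable def factorialSum {X : Type*} [TopologicalSpace X] {n : ℕ} (ω : Config X)
    (K : (Fin n → X) → ℝ≥0∞) : ℝ≥0∞ :=
  ∑' e : Fin n ↪ ω.carrier, K fun i => e i

lemma factorialSum_zero {X : Type*} [TopologicalSpace X] (ω : Config X)
    (K : (Fin 0 → X) → ℝ≥0∞) (x : Fin 0 → X) : factorialSum ω K = K x := by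
  rw [factorialSum, tsum_eq_single Embedding.ofIsEmpty fun e he =>
    (he (Subsingleton.elim _ _)).elim]
  exact congrArg K (Subsingleton.elim _ _)

section FactorialSum

variable {X : Type*} [MetricSpace X] [SigmaCompactSpace X] [MeasurableSpace X] [BorelSpace X]

lemma factorialSum_succ {n : ℕ} (ω : Config X) (K : (Fin (n + 1) → X) → ℝ≥0∞) :
    factorialSum ω K = factorialSum ω fun x =>
      ∫⁻ y, (Set.range x)ᶜ.indicator (fun y => K (Fin.cons y x)) y ∂ω.toMeasure := by
  rw [factorialSum, ← (Equiv.embeddingFinSucc n ω.carrier).symm.tsum_eq, ENNReal.tsum_sigma']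
  refine tsum_congr fun e => ?_
  have hcons (y : {y // y ∉ Set.range e}) :
      (fun i => (((Equiv.embeddingFinSucc n ω.carrier).symm ⟨e, y⟩ i : ω.carrier) : X)) =
        Fin.cons (y : X) fun i => (e i : X) := by
    ext i
    rw [Equiv.coe_embeddingFinSucc_symm]
    cases i using Fin.cases <;> rfl
  refine (tsum_congr fun y => congrArg K (hcons y)).trans ?_
  refine (tsum_subtype (Set.range e)ᶜ fun y : ω.carrier =>
    K (Fin.cons (y : X) fun i => (e i : X))).trans ?_
  refine (tsum_congr fun y => ?_).trans (lintegral_toMeasure ω _).symm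
  classical
  simp [Set.indicator_apply, Subtype.ext_iff]

lemma measurable_indicator_range_compl {α : Type*} [MeasurableSpace α] {n : ℕ}
    {y : α → X} (hy : Measurable y) {x : α → Fin n → X} (hx : Measurable x)
    {F : α → X → ℝ≥0∞} (hF : Measurable fun a => F a (y a)) :
    Measurable fun a => (Set.range (x a))ᶜ.indicator (F a) (y a) := by
  classical
  have hmem : MeasurableSet {a | y a ∈ (Set.range (x a))ᶜ} := by
    have : {a | y a ∈ (Set.range (x a))ᶜ} = ⋂ i, {a | x a i = y a}ᶜ := by
      ext a
      simp
    rw [this]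
    exact .iInter fun i =>
      (measurableSet_eq_fun ((measurable_pi_apply i).comp hx) hy).compl
  simp only [Set.indicator_apply]
  exact Measurable.ite hmem hF measurable_const

lemma measurable_lintegral_indicator_range_compl {n : ℕ}
    {K : Config X → (Fin (n + 1) → X) → ℝ≥0∞} (hK : Measurable (uncurry K)) :
    Measurable (uncurry fun (ω : Config X) (x : Fin n → X) =>
      ∫⁻ y, (Set.range x)ᶜ.indicator (fun y => K ω (Fin.cons y x)) y ∂ω.toMeasure) := by
  refine measurable_lintegral_toMeasure (f := fun p : Config X × (Fin n → X) =>
    (Set.range p.2)ᶜ.indicator fun y => K p.1 (Fin.cons y p.2)) measurable_fst ?_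
  refine measurable_indicator_range_compl
    (F := fun p : (Config X × (Fin n → X)) × X => fun y => K p.1.1 (Fin.cons y p.1.2))
    measurable_snd (measurable_snd.comp measurable_fst) ?_
  exact hK.comp <| (measurable_fst.comp measurable_fst).prodMk <|
    measurable_finCons measurable_snd (measurable_snd.comp measurable_fst)

lemma measurable_factorialSum {n : ℕ} {K : Config X → (Fin n → X) → ℝ≥0∞}
    (hK : Measurable (uncurry K)) : Measurable fun ω => factorialSum ω (K ω) := by
  induction n with
  | zero =>
    simp only [factorialSum_zero _ _ Fin.elim0]
    exact hK.comp (measurable_id.prodMk measurable_const)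
  | succ n ih =>
    simp only [factorialSum_succ]
    exact ih (measurable_lintegral_indicator_range_compl hK)

lemma lintegral_indicator_range_compl_addRange {n : ℕ} (ω : Config X) (x : Fin n → X)
    (g : X → ℝ≥0∞) :
    ∫⁻ y, (Set.range x)ᶜ.indicator g y ∂(ω.addRange x).toMeasure =
      ∫⁻ y, (Set.range x)ᶜ.indicator g y ∂ω.toMeasure := by
  simp only [lintegral_toMeasure, tsum_subtype _ fun y => (Set.range x)ᶜ.indicator g y,
    Set.indicator_indicator, carrier_addRange, Set.union_inter_distrib_right, Set.inter_compl_self,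
    Set.union_empty]

variable {σ : Measure X} [IsFiniteMeasureOnCompacts σ] [NullSingletonClass σ]
  {P : Measure (Config X)}

lemma IsPoissonMeasure.lintegral_lintegral_finCons (hP : IsPoissonMeasure σ P) {n : ℕ}
    {K : Config X → (Fin (n + 1) → X) → ℝ≥0∞} (hK : Measurable (uncurry K)) (x : Fin n → X) :
    ∫⁻ ω, ∫⁻ y, (Set.range x)ᶜ.indicator (fun y => K (ω.addRange x) (Fin.cons y x)) y
        ∂ω.toMeasure ∂P =
      ∫⁻ ω, ∫⁻ y, K (ω.addRange (Fin.cons y x : Fin (n + 1) → X)) (Fin.cons y x) ∂σ ∂P := by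
  have hx : ∀ᵐ y ∂σ, y ∈ (Set.range x)ᶜ :=
    measure_eq_zero_iff_ae_notMem.1 ((Set.finite_range x).measure_zero σ)
  rw [hP.mecke_formula (F := fun ω =>
    (Set.range x)ᶜ.indicator fun y => K (ω.addRange x) (Fin.cons y x))]
  · refine lintegral_congr fun ω => lintegral_congr_ae ?_
    filter_upwards [hx] with y hy
    rw [Set.indicator_of_mem hy, addRange_finCons]
  · refine measurable_indicator_range_compl
      (F := fun p : Config X × X => fun y => K (p.1.addRange x) (Fin.cons y x))
      measurable_snd measurable_const ?_
    exact hK.comp <| (measurable_addRange.comp (measurable_fst.prodMk measurable_const)).prodMk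
      (measurable_finCons measurable_snd measurable_const)

theorem IsPoissonMeasure.iterated_mecke_formula (hP : IsPoissonMeasure σ P) {n : ℕ}
    {K : Config X → (Fin n → X) → ℝ≥0∞} (hK : Measurable (uncurry K)) :
    ∫⁻ ω, factorialSum ω (K ω) ∂P =
      ∫⁻ ω, ∫⁻ x, K (ω.addRange x) x ∂(Measure.pi fun _ => σ) ∂P := by
  have := hP.isProbabilityMeasure
  induction n with
  | zero =>
    refine lintegral_congr fun ω => ?_
    simp only [addRange_of_isEmpty, ← factorialSum_zero ω (K ω)]
    simp
  | succ n ih =>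
    have hK_add : Measurable fun p : Config X × (Fin (n + 1) → X) => K (p.1.addRange p.2) p.2 :=
      hK.comp (measurable_addRange.prodMk measurable_snd)
    let K' (ω : Config X) (x : Fin n → X) : ℝ≥0∞ :=
      ∫⁻ y, (Set.range x)ᶜ.indicator (fun y => K ω (Fin.cons y x)) y ∂ω.toMeasure
    have hK' : Measurable (uncurry K') := measurable_lintegral_indicator_range_compl hK
    calc ∫⁻ ω, factorialSum ω (K ω) ∂P
        = ∫⁻ ω, ∫⁻ x, K' (ω.addRange x) x ∂(Measure.pi fun _ => σ) ∂P := by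
          simp only [factorialSum_succ, ← ih hK', K']
      _ = ∫⁻ x, ∫⁻ ω, K' (ω.addRange x) x ∂P ∂(Measure.pi fun _ => σ) :=
          lintegral_lintegral_swap
            (hK'.comp (measurable_addRange.prodMk measurable_snd)).aemeasurable
      _ = ∫⁻ x, ∫⁻ ω, ∫⁻ y, K (ω.addRange (Fin.cons y x : Fin (n + 1) → X)) (Fin.cons y x)
            ∂σ ∂P ∂(Measure.pi fun _ => σ) := by
          simp only [K', lintegral_indicator_range_compl_addRange,
            hP.lintegral_lintegral_finCons hK]
      _ = ∫⁻ ω, ∫⁻ x, ∫⁻ y, K (ω.addRange (Fin.cons y x : Fin (n + 1) → X)) (Fin.cons y x)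
            ∂σ ∂(Measure.pi fun _ => σ) ∂P := by
          refine lintegral_lintegral_swap (Measurable.lintegral_prod_right'
            (f := fun p : ((Fin n → X) × Config X) × X =>
              K (p.1.2.addRange (Fin.cons p.2 p.1.1 : Fin (n + 1) → X)) (Fin.cons p.2 p.1.1))
            ?_).aemeasurable
          exact hK_add.comp <| (measurable_snd.comp measurable_fst).prodMk <|
            measurable_finCons measurable_snd (measurable_fst.comp measurable_fst)
      _ = ∫⁻ ω, ∫⁻ x, K (ω.addRange x) x ∂(Measure.pi fun _ => σ) ∂P :=
          lintegral_congr fun ω =>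
            (lintegral_pi_fin_succ σ (hK_add.comp measurable_prodMk_left)).symm

end FactorialSum

end Config

section LocallyFinite

lemma isCompact_insert_iUnion {Y ι : Type*} [TopologicalSpace Y] {C : ι → Set Y} {y : Y}
    (hC : ∀ i, IsCompact (C i)) (hCy : Tendsto C cofinite (𝓝 y).smallSets) :
    IsCompact (insert y (⋃ i, C i)) := by
  refine isCompact_iff_ultrafilter_le_nhds.2 fun f hf => ?_
  by_cases h : ∃ i, C i ∈ f
  · obtain ⟨i, hi⟩ := h
    obtain ⟨x, hx, hfx⟩ := isCompact_iff_ultrafilter_le_nhds.1 (hC i) f (le_principal_iff.2 hi)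
    exact ⟨x, Or.inr (Set.mem_iUnion.2 ⟨i, hx⟩), hfx⟩
  · refine ⟨y, Set.mem_insert y _, fun U hU => ?_⟩
    have hfinite : {i | ¬ C i ⊆ U}.Finite := hCy (eventually_smallSets_subset.2 hU)
    have hcompl : ⋂ i ∈ {i | ¬ C i ⊆ U}, (C i)ᶜ ∈ f :=
      (biInter_mem hfinite).2 fun i _ => Ultrafilter.compl_mem_iff_notMem.2 (not_exists.1 h i)
    filter_upwards [le_principal_iff.1 hf, hcompl] with x hx hxC
    rcases hx with rfl | hx
    · exact mem_of_mem_nhds hU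
    · obtain ⟨i, hi⟩ := Set.mem_iUnion.1 hx
      by_contra hxU
      exact Set.mem_iInter₂.1 hxC i (fun hCU => hxU (hCU hi)) hi

/-- Without local compactness: if all neighbourhoods of a point had infinite measure, they would
contain compact sets of arbitrarily large measure whose union with that point is compact. -/
lemma isLocallyFiniteMeasure_of_sigmaCompactSpace {Y : Type*} [TopologicalSpace Y] [RegularSpace Y]
    [FirstCountableTopology Y] [SigmaCompactSpace Y] [MeasurableSpace Y] (μ : Measure Y)
    [IsFiniteMeasureOnCompacts μ] : IsLocallyFiniteMeasure μ := by
  refine ⟨fun y => ?_⟩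
  by_contra hinfinite
  have hnhds (U : Set Y) (hU : U ∈ 𝓝 y) : μ U = ∞ :=
    not_lt_top_iff.1 fun hlt => hinfinite ⟨U, hU, hlt⟩
  obtain ⟨U, hU, hbasis⟩ := (closed_nhds_basis y).exists_antitone_subbasis
  have hlarge (n : ℕ) : ∃ C ⊆ U n, IsCompact C ∧ n < μ C := by
    have hmono : Monotone fun k => U n ∩ compactCovering Y k := fun k l hkl =>
      Set.inter_subset_inter_right _ (compactCovering_subset Y hkl)
    have hsup := hmono.measure_iUnion (μ := μ)
    rw [← Set.inter_iUnion, iUnion_compactCovering, Set.inter_univ, hnhds _ (hU n).1] at hsup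
    obtain ⟨k, hk⟩ := lt_iSup_iff.1 (hsup ▸ ENNReal.natCast_lt_top n)
    exact ⟨_, Set.inter_subset_left, (isCompact_compactCovering Y k).inter_left (hU n).2, hk⟩
  choose C hCU hC hlt using hlarge
  have hCy : Tendsto C cofinite (𝓝 y).smallSets := by
    rw [Nat.cofinite_eq_atTop]
    exact hbasis.tendsto_smallSets.smallSets_mono (.of_forall hCU)
  have hK := isCompact_insert_iUnion hC hCy
  obtain ⟨n, hn⟩ := ENNReal.exists_nat_gt (hK.measure_ne_top (μ := μ))
  refine hn.not_ge ((hlt n).le.trans (measure_mono ?_))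
  exact (Set.subset_iUnion C n).trans (Set.subset_insert _ _)

end LocallyFinite

lemma lintegral_pi_fin_prod {E : Type*} [MeasurableSpace E] (ν : Measure E) [SigmaFinite ν]
    (n : ℕ) {g : E → ℝ≥0∞} (hg : Measurable g) :
    ∫⁻ x, ∏ i, g (x i) ∂(Measure.pi fun _ : Fin n => ν) = (∫⁻ y, g y ∂ν) ^ n := by
  induction n with
  | zero => simp
  | succ n ih =>
    rw [lintegral_pi_fin_succ ν (by fun_prop)]
    simp only [Fin.prod_univ_succ, Fin.cons_zero, Fin.cons_succ, lintegral_mul_const _ hg]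
    rw [lintegral_const_mul _ (by fun_prop), ih, pow_succ']

lemma pi_setOf_apply_zero_eq_apply_one {E : Type*} [MeasurableSpace E] [MeasurableEq E]
    (ν : Measure E) [SigmaFinite ν] [NullSingletonClass ν] :
    (Measure.pi fun _ : Fin 2 => ν) {x | x 0 = x 1} = 0 := by
  have hdiag : (ν.prod ν) (Set.diagonal E) = 0 := by
    refine (Measure.measure_prod_null measurableSet_diagonal).2 (ae_of_all _ fun x => ?_)
    exact measure_mono_null (fun _ h => Eq.symm h) (measure_singleton x)
  exact (measurePreserving_finTwoArrow ν).measure_preimage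
    measurableSet_diagonal.nullMeasurableSet |>.trans hdiag

lemma integral_eq_exp_neg_of_hasSum {Ω : Type*} [MeasurableSpace Ω] {P : Measure Ω}
    {D : ℕ → Ω → ℝ≥0∞} {G : Ω → ℝ} {c : ℝ≥0} (hD : ∀ n, Measurable (D n))
    (hmoment : ∀ n, ∫⁻ ω, D n ω ∂P = c ^ n)
    (hsum : ∀ᵐ ω ∂P, HasSum (fun n : ℕ => (-1) ^ n / n.factorial * (D n ω).toReal) (G ω)) :
    ∫ ω, G ω ∂P = Real.exp (-c) := by
  have hfin (n : ℕ) : ∫⁻ ω, D n ω ∂P ≠ ∞ := by simp [hmoment]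
  have hreal (n : ℕ) : ∫ ω, (D n ω).toReal ∂P = c ^ n := by
    rw [integral_toReal (hD n).aemeasurable (ae_lt_top (hD n) (hfin n)), hmoment]
    simp
  let A (n : ℕ) (ω : Ω) : ℝ := (-1) ^ n / n.factorial * (D n ω).toReal
  have hint (n : ℕ) : Integrable (A n) P :=
    (integrable_toReal_of_lintegral_ne_top (hD n).aemeasurable (hfin n)).const_mul _
  have hnorm (n : ℕ) : ∫ ω, ‖A n ω‖ ∂P = c ^ n / n.factorial := by
    simp [A, integral_const_mul, hreal, div_eq_inv_mul]
  have hterm (n : ℕ) : ∫ ω, A n ω ∂P = (-c) ^ n / n.factorial := by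
    simp only [A, integral_const_mul, hreal]
    rw [neg_pow (c : ℝ), div_mul_eq_mul_div]
  have hexp : HasSum (fun n => ∫ ω, A n ω ∂P) (Real.exp (-c)) := by
    simp only [hterm, Real.exp_eq_exp_ℝ]
    exact NormedSpace.expSeries_div_hasSum_exp (-c : ℝ)
  have hsummable : Summable fun n => ∫ ω, ‖A n ω‖ ∂P := by
    simp only [hnorm]
    exact Real.summable_pow_div_factorial c
  rw [← (hasSum_integral_of_summable_integral_norm hint hsummable).unique hexp]
  exact integral_congr_ae (hsum.mono fun ω hω => hω.tsum_eq.symm)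

lemma lintegral_one_sub_expNeg_le {E : Type*} [MeasurableSpace E] (ν : Measure E)
    {f : E → ℝ≥0∞} (hf : Measurable f) : ∫⁻ y, (1 - expNeg (f y)) ∂ν ≤ ν (support f) := by
  rw [← lintegral_indicator_one (measurableSet_support hf)]
  refine lintegral_mono fun y => ?_
  by_cases hy : f y = 0
  · simp [hy]
  · simp [hy]

namespace Config

lemma measurable_comp_apply_pi {X Y ι : Type*} [TopologicalSpace X] [MeasurableSpace X]
    [MeasurableSpace Y] {τ : Config X → X → Y} (hτ : Measurable (uncurry τ))
    {K : (ι → Y) → ℝ≥0∞} (hK : Measurable K) :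
    Measurable (uncurry fun (ω : Config X) (x : ι → X) => K fun i => τ ω (x i)) :=
  hK.comp <| measurable_pi_lambda _ fun i =>
    hτ.comp (measurable_fst.prodMk ((measurable_pi_apply i).comp measurable_snd))

section Image

variable {X Y : Type*} [MetricSpace X] [SigmaCompactSpace X] [MeasurableSpace X] [BorelSpace X]
  [MeasurableSpace Y] {σ : Measure X} {μ : Measure Y} {P : Measure (Config X)}
  {τ : Config X → X → Y}

lemma lintegral_imageMeasure (τ : Config X → X → Y) (ω : Config X) {f : Y → ℝ≥0∞}
    (hf : Measurable f) : ∫⁻ y, f y ∂imageMeasure τ ω = ∫⁻ x, f (τ ω x) ∂ω.toMeasure := by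
  simp only [imageMeasure, lintegral_sum_measure, lintegral_dirac' _ hf, lintegral_toMeasure]

lemma measurable_lintegral_imageMeasure (hτ : Measurable (uncurry τ)) {f : Y → ℝ≥0∞}
    (hf : Measurable f) : Measurable fun ω => ∫⁻ y, f y ∂imageMeasure τ ω := by
  simp only [lintegral_imageMeasure τ _ hf]
  exact measurable_lintegral_toMeasure (f := fun ω x => f (τ ω x)) measurable_id (hf.comp hτ)

lemma measurable_imageMeasure (hτ : Measurable (uncurry τ)) : Measurable (imageMeasure τ) := by
  refine Measure.measurable_of_measurable_coe _ fun B hB => ?_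
  simp only [← lintegral_indicator_one hB]
  exact measurable_lintegral_imageMeasure hτ (measurable_one.indicator hB)

lemma hasSum_factorialSum (ω : Config X) {f : X → ℝ≥0∞}
    (hf : (support fun x : ω.carrier => f x).Finite) :
    HasSum (fun n : ℕ => (-1) ^ n / n.factorial *
      (factorialSum ω fun x : Fin n → X => ∏ i, (1 - expNeg (f (x i)))).toReal)
        (expNeg (∫⁻ x, f x ∂ω.toMeasure)).toReal := by
  simpa only [factorialSum, lintegral_toMeasure] using
    hasSum_neg_one_pow_div_factorial_mul_tsum_embedding hf

variable [IsFiniteMeasureOnCompacts σ] [NullSingletonClass σ]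

lemma IsPoissonMeasure.lintegral_lintegral_imageMeasure (hP : IsPoissonMeasure σ P)
    (hcyc : CyclicCondition τ) (hτ : Measurable (uncurry τ)) (hpush : ∀ ω, σ.map (τ ω) = μ)
    {f : Y → ℝ≥0∞} (hf : Measurable f) :
    ∫⁻ ω, ∫⁻ y, f y ∂imageMeasure τ ω ∂P = ∫⁻ y, f y ∂μ := by
  have := hP.isProbabilityMeasure
  have hτω (ω : Config X) : Measurable (τ ω) := hτ.comp measurable_prodMk_left
  simp only [lintegral_imageMeasure τ _ hf]
  rw [hP.mecke_formula (F := fun ω x => f (τ ω x)) (hf.comp hτ)]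
  simp only [hcyc.add_self, ← lintegral_map hf (hτω _), hpush]
  simp

lemma IsPoissonMeasure.ae_finite_preimage (hP : IsPoissonMeasure σ P)
    (hcyc : CyclicCondition τ) (hτ : Measurable (uncurry τ)) (hpush : ∀ ω, σ.map (τ ω) = μ)
    {B : Set Y} (hB : MeasurableSet B) (hfin : μ B ≠ ∞) :
    ∀ᵐ ω ∂P, {x : ω.carrier | τ ω x ∈ B}.Finite := by
  have hind : Measurable (B.indicator (1 : Y → ℝ≥0∞)) := measurable_one.indicator hB
  have hmean := hP.lintegral_lintegral_imageMeasure hcyc hτ hpush hind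
  rw [lintegral_indicator_one hB] at hmean
  filter_upwards [ae_lt_top (measurable_lintegral_imageMeasure hτ hind) (hmean ▸ hfin)] with ω hω
  rw [lintegral_imageMeasure τ ω hind, lintegral_toMeasure] at hω
  refine (ENNReal.finite_const_le_of_tsum_ne_top hω.ne one_ne_zero).subset ?_
  rintro x (hx : τ ω x ∈ B)
  simp [hx]

theorem IsPoissonMeasure.lintegral_factorialSum_comp [SigmaFinite μ] (hP : IsPoissonMeasure σ P)
    (hcyc : CyclicCondition τ) (hτ : Measurable (uncurry τ)) (hpush : ∀ ω, σ.map (τ ω) = μ)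
    {n : ℕ} {K : (Fin n → Y) → ℝ≥0∞} (hK : Measurable K) :
    ∫⁻ ω, factorialSum ω (fun x => K fun i => τ ω (x i)) ∂P =
      ∫⁻ y, K y ∂(Measure.pi fun _ => μ) := by
  have := hP.isProbabilityMeasure
  have hadd (ω : Config X) : Measurable fun (x : Fin n → X) i => τ (ω.addRange x) (x i) :=
    (measurable_addRange_apply hτ).comp measurable_prodMk_left
  rw [hP.iterated_mecke_formula (measurable_comp_apply_pi hτ hK)]
  simp only [← lintegral_map hK (hadd _), hcyc.map_pi hτ hpush]
  simp

lemma IsPoissonMeasure.ae_injOn [MeasurableEq Y] [SigmaFinite μ] [NullSingletonClass μ]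
    (hP : IsPoissonMeasure σ P) (hcyc : CyclicCondition τ) (hτ : Measurable (uncurry τ))
    (hpush : ∀ ω, σ.map (τ ω) = μ) : ∀ᵐ ω ∂P, Set.InjOn (τ ω) ω.carrier := by
  let K : (Fin 2 → Y) → ℝ≥0∞ := Set.indicator {y | y 0 = y 1} 1
  have heq : MeasurableSet {y : Fin 2 → Y | y 0 = y 1} :=
    measurableSet_eq_fun (measurable_pi_apply 0) (measurable_pi_apply 1)
  have hK : Measurable K := measurable_one.indicator heq
  have hzero := hP.lintegral_factorialSum_comp hcyc hτ hpush hK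
  rw [lintegral_indicator_one heq, pi_setOf_apply_zero_eq_apply_one,
    lintegral_eq_zero_iff (measurable_factorialSum (measurable_comp_apply_pi hτ hK))] at hzero
  filter_upwards [hzero] with ω hω x hx y hy hxy
  by_contra hne
  let e : Fin 2 ↪ ω.carrier := ⟨![⟨x, hx⟩, ⟨y, hy⟩], by
    simpa [Injective, Fin.forall_fin_two, eq_comm] using hne⟩
  have he : K (fun i => τ ω (e i)) = 0 := ENNReal.tsum_eq_zero.1 hω e
  simp [K, e, hxy] at he

lemma IsPoissonMeasure.lintegral_expNeg_imageMeasure [SigmaFinite μ] (hP : IsPoissonMeasure σ P)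
    (hcyc : CyclicCondition τ) (hτ : Measurable (uncurry τ)) (hpush : ∀ ω, σ.map (τ ω) = μ)
    {f : Y → ℝ≥0∞} (hf : Measurable f) (hsupp : μ (support f) ≠ ∞) :
    ∫⁻ ω, expNeg (∫⁻ y, f y ∂imageMeasure τ ω) ∂P = expNeg (∫⁻ y, (1 - expNeg (f y)) ∂μ) := by
  have := hP.isProbabilityMeasure
  let g (y : Y) : ℝ≥0∞ := 1 - expNeg (f y)
  have hg : Measurable g := by fun_prop
  have hgprod (n : ℕ) : Measurable fun y : Fin n → Y => ∏ i, g (y i) := by fun_prop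
  have hfin : ∫⁻ y, g y ∂μ ≠ ∞ := ne_top_of_le_ne_top hsupp (lintegral_one_sub_expNeg_le μ hf)
  lift ∫⁻ y, g y ∂μ to ℝ≥0 using hfin with c hc
  let D (n : ℕ) (ω : Config X) : ℝ≥0∞ := factorialSum ω fun x : Fin n → X => ∏ i, g (τ ω (x i))
  have hD (n : ℕ) : Measurable (D n) :=
    measurable_factorialSum (measurable_comp_apply_pi hτ (hgprod n))
  have hmoment (n : ℕ) : ∫⁻ ω, D n ω ∂P = c ^ n := by
    rw [hP.lintegral_factorialSum_comp hcyc hτ hpush (hgprod n), lintegral_pi_fin_prod μ n hg, hc]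
  have hsum : ∀ᵐ ω ∂P, HasSum (fun n : ℕ => (-1) ^ n / n.factorial * (D n ω).toReal)
      (expNeg (∫⁻ y, f y ∂imageMeasure τ ω)).toReal := by
    filter_upwards [hP.ae_finite_preimage hcyc hτ hpush (measurableSet_support hf) hsupp] with ω hω
    rw [lintegral_imageMeasure τ ω hf]
    exact hasSum_factorialSum ω (f := fun x => f (τ ω x)) hω
  have hexp := integral_eq_exp_neg_of_hasSum hD hmoment hsum
  have hmeas : Measurable fun ω => expNeg (∫⁻ y, f y ∂imageMeasure τ ω) :=
    measurable_expNeg.comp (measurable_lintegral_imageMeasure hτ hf)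
  have hne : ∫⁻ ω, expNeg (∫⁻ y, f y ∂imageMeasure τ ω) ∂P ≠ ∞ :=
    ne_top_of_le_ne_top ENNReal.one_ne_top <|
      (lintegral_mono fun ω => expNeg_le_one _).trans (by simp)
  rw [integral_toReal hmeas.aemeasurable (ae_of_all _ fun ω => (expNeg_ne_top _).lt_top)] at hexp
  rw [← ENNReal.ofReal_toReal hne, hexp, ← expNeg_coe, hc]

end Image

section Characterization

variable {X : Type*} [MetricSpace X] [SigmaCompactSpace X] [MeasurableSpace X] [BorelSpace X]
  {σ : Measure X} [IsFiniteMeasureOnCompacts σ] {P : Measure (Config X)} [IsProbabilityMeasure P]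

lemma map_count_eq_pi_poissonMeasure
    (h : ∀ f, Measurable f → σ (support f) ≠ ∞ → LaplaceIdentity σ P f)
    {ι : Type*} [Fintype ι] {A : ι → Set X} (hA : ∀ i, IsCompact (A i))
    (hdisj : Pairwise (Disjoint on A)) :
    P.map (fun ω i => count (A i) ω) = Measure.pi fun i => poissonMeasure (σ (A i)).toNNReal := by
  have hcount : Measurable fun (ω : Config X) i => count (A i) ω :=
    measurable_pi_lambda _ fun i => measurable_count (hA i)
  refine _root_.ext_of_lintegral_expNeg (φ := fun i (n : ι → ℕ) => (n i : ℝ≥0∞))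
    (fun i => continuous_of_discreteTopology.comp (continuous_apply i))
    (fun m n hmn => funext fun i => Nat.cast_injective (congrFun hmn i)) fun t => ?_
  have hexp (i : ι) : Measurable fun n : ℕ => expNeg (t i * n) := by fun_prop
  let f (x : X) : ℝ≥0∞ := ∑ i, (A i).indicator (fun _ => (t i : ℝ≥0∞)) x
  have hf : Measurable f := Finset.measurable_fun_sum _ fun i _ =>
    measurable_const.indicator (hA i).measurableSet
  have hsupp : support f ⊆ ⋃ i, A i := support_subset_iff'.2 fun x hx =>
    Finset.sum_eq_zero fun i _ =>
      Set.indicator_of_notMem (fun hxi => hx (Set.mem_iUnion_of_mem i hxi)) _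
  have hfin : σ (support f) ≠ ∞ :=
    measure_ne_top_of_subset hsupp (isCompact_iUnion hA).measure_ne_top
  calc ∫⁻ n, expNeg (∑ i, t i * (n i : ℝ≥0∞)) ∂P.map (fun ω i => count (A i) ω)
      = ∫⁻ ω, expNeg (∫⁻ x, f x ∂ω.toMeasure) ∂P := by
        rw [lintegral_map (by fun_prop) hcount]
        simp only [f, lintegral_toMeasure_sum_indicator hA]
    _ = ∏ i, expNeg ((1 - expNeg (t i)) * σ (A i)) := by
        rw [h f hf hfin,
          lintegral_one_sub_expNeg_sum_indicator (fun i => (hA i).measurableSet) hdisj, expNeg_sum]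
    _ = ∏ i, ∫⁻ n : ℕ, expNeg (t i * n) ∂poissonMeasure (σ (A i)).toNNReal := by
        simp only [lintegral_expNeg_poissonMeasure, ENNReal.coe_toNNReal (hA _).measure_ne_top]
    _ = ∫⁻ n, expNeg (∑ i, t i * (n i : ℝ≥0∞))
          ∂(Measure.pi fun i => poissonMeasure (σ (A i)).toNNReal) := by
        simp only [expNeg_sum]
        rw [lintegral_prod_eq_prod_lintegral_of_indepFun _ _
          (iIndepFun_pi fun i => (hexp i).aemeasurable) fun i => by fun_prop]
        exact Finset.prod_congr rfl fun i _ =>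
          ((measurePreserving_eval (fun i => poissonMeasure (σ (A i)).toNNReal) i).lintegral_comp
            (hexp i)).symm

lemma isPoissonMeasure_of_laplaceIdentity
    (h : ∀ f, Measurable f → σ (support f) ≠ ∞ → LaplaceIdentity σ P f) :
    IsPoissonMeasure σ P := by
  have hmap (A : Set X) (hA : IsCompact A) :
      P.map (count A) = poissonMeasure (σ A).toNNReal := by
    have hunit := map_count_eq_pi_poissonMeasure h (fun _ : Unit => hA) Subsingleton.pairwise
    rw [← (measurePreserving_eval (fun _ : Unit => poissonMeasure (σ A).toNNReal) ()).map_eq,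
      ← hunit, Measure.map_map (measurable_pi_apply _)
        (measurable_pi_lambda _ fun _ => measurable_count hA)]
    rfl
  refine ⟨inferInstance, fun A hA => ⟨(measurable_count hA).aemeasurable, hmap A hA⟩,
    fun n A hA hdisj => ?_⟩
  rw [iIndepFun_iff_map_fun_eq_pi_map fun i => (measurable_count (hA i)).aemeasurable,
    map_count_eq_pi_poissonMeasure h hA hdisj]
  simp only [hmap _ (hA _)]

end Characterization

section Push

variable {X Y : Type*} [MetricSpace X] [SigmaCompactSpace X] [MeasurableSpace X] [BorelSpace X]
  [MetricSpace Y] [SigmaCompactSpace Y] [MeasurableSpace Y] [BorelSpace Y]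
  {σ : Measure X} {μ : Measure Y} {P : Measure (Config X)} {τ : Config X → X → Y}

/-- The points of the image of `ω` are distinct and locally finite, so that `push τ ω` is not the
default value of `push`. -/
def HasPush {X Y : Type*} [TopologicalSpace X] [TopologicalSpace Y] (τ : Config X → X → Y)
    (ω : Config X) : Prop :=
  Set.InjOn (τ ω) ω.carrier ∧ ∀ K : Set Y, IsCompact K → ((τ ω '' ω.carrier) ∩ K).Finite

lemma HasPush.toMeasure_push {ω : Config X} (h : HasPush τ ω) :
    (push τ ω).toMeasure = imageMeasure τ ω := by
  have hcarrier : (push τ ω).carrier = τ ω '' ω.carrier := by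
    rw [push, dif_pos ⟨h.1, h.2⟩]
  refine Measure.ext_of_lintegral _ fun f hf => ?_
  rw [lintegral_toMeasure, lintegral_imageMeasure τ ω hf, lintegral_toMeasure, hcarrier,
    tsum_image f h.1]

lemma aemeasurable_push (hτ : Measurable (uncurry τ)) (h : ∀ᵐ ω ∂P, HasPush τ ω) :
    AEMeasurable (push τ) P := by
  classical
  obtain ⟨N, hsub, hNm, hN⟩ := exists_measurable_superset_of_null (ae_iff.1 h)
  have hmeasure : (fun ω => (if ω ∈ N then empty else push τ ω).toMeasure) =
      fun ω => if ω ∈ N then (empty : Config Y).toMeasure else imageMeasure τ ω := by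
    ext1 ω
    split_ifs with hω
    · rfl
    · exact (not_not.1 fun hω' => hω (hsub hω') : HasPush τ ω).toMeasure_push
  refine ⟨fun ω => if ω ∈ N then empty else push τ ω, measurable_of_toMeasure ?_, ?_⟩
  · rw [hmeasure]
    exact Measurable.ite hNm measurable_const (measurable_imageMeasure hτ)
  · filter_upwards [measure_eq_zero_iff_ae_notMem.1 hN] with ω hω
    rw [if_neg hω]

variable [IsFiniteMeasureOnCompacts σ] [NullSingletonClass σ]
  [IsFiniteMeasureOnCompacts μ] [NullSingletonClass μ]

lemma IsPoissonMeasure.ae_hasPush (hP : IsPoissonMeasure σ P) (hcyc : CyclicCondition τ)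
    (hτ : Measurable (uncurry τ)) (hpush : ∀ ω, σ.map (τ ω) = μ) : ∀ᵐ ω ∂P, HasPush τ ω := by
  have := isLocallyFiniteMeasure_of_sigmaCompactSpace μ
  let U := μ.finiteSpanningSetsInOpen'
  have hU (n : ℕ) : IsOpen (U.set n) := U.set_mem n
  have hfin : ∀ᵐ ω ∂P, ∀ n, {x : ω.carrier | τ ω x ∈ U.set n}.Finite :=
    ae_all_iff.2 fun n =>
      hP.ae_finite_preimage hcyc hτ hpush (hU n).measurableSet (U.finite n).ne
  filter_upwards [hP.ae_injOn hcyc hτ hpush, hfin] with ω hinj hω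
  refine ⟨hinj, fun K hK => ?_⟩
  obtain ⟨t, ht⟩ := hK.elim_finite_subcover U.set hU (by simp [U.spanning])
  refine (t.finite_toSet.biUnion fun n _ => (hω n).image fun x : ω.carrier => τ ω x).subset ?_
  rintro _ ⟨⟨x, hx, rfl⟩, hxK⟩
  obtain ⟨n, hn, hxn⟩ := Set.mem_iUnion₂.1 (ht hxK)
  exact Set.mem_iUnion₂.2 ⟨n, hn, ⟨x, hx⟩, hxn, rfl⟩

lemma IsPoissonMeasure.map_push (hP : IsPoissonMeasure σ P) (hcyc : CyclicCondition τ)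
    (hτ : Measurable (uncurry τ)) (hpush : ∀ ω, σ.map (τ ω) = μ) :
    IsPoissonMeasure μ (P.map (push τ)) := by
  have hae := hP.ae_hasPush hcyc hτ hpush
  have hmeas := aemeasurable_push hτ hae
  have := hP.isProbabilityMeasure
  have := Measure.isProbabilityMeasure_map hmeas
  refine isPoissonMeasure_of_laplaceIdentity fun f hf hsupp => ?_
  rw [LaplaceIdentity, lintegral_map' (measurable_expNeg_lintegral_toMeasure hf).aemeasurable hmeas,
    ← hP.lintegral_expNeg_imageMeasure hcyc hτ hpush hf hsupp]
  exact lintegral_congr_ae (hae.mono fun ω hω => by simp only [hω.toMeasure_push])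

end Push

end Config

theorem theorem3p2 {X Y : Type*}
    [MetricSpace X] [SigmaCompactSpace X] [MeasurableSpace X] [BorelSpace X]
    [MetricSpace Y] [SigmaCompactSpace Y] [MeasurableSpace Y] [BorelSpace Y]
    (σ : Measure X) [IsFiniteMeasureOnCompacts σ] [NullSingletonClass σ]
    (μ : Measure Y) [IsFiniteMeasureOnCompacts μ] [NullSingletonClass μ]
    (πσ : Measure (Config X)) (hπσ : Config.IsPoissonMeasure σ πσ)
    (τ : Config X → X → Y) (hτ : Measurable (Function.uncurry τ))
    (hpush : ∀ ω : Config X, σ.map (τ ω) = μ)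
    (hcyclic : Config.CyclicCondition τ) :
    (∀ᵐ ω ∂πσ, (Config.push τ ω).toMeasure = Config.imageMeasure τ ω) ∧
    AEMeasurable (Config.push τ) πσ ∧
    Config.IsPoissonMeasure μ (πσ.map (Config.push τ)) ∧
    (∀ πμ : Measure (Config Y), Config.IsPoissonMeasure μ πμ → πσ.map (Config.push τ) = πμ) := by
  have hae := hπσ.ae_hasPush hcyclic hτ hpush
  have hpoisson := hπσ.map_push hcyclic hτ hpush
  exact ⟨hae.mono fun ω hω => hω.toMeasure_push, Config.aemeasurable_push hτ hae, hpoisson,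
    fun πμ hπμ => hpoisson.unique hπμ⟩
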